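/- Let $\mathcal M$ be a von Neumann algebra with a normal faithful tracial state $\tau$. Let $L_1(\mathcal M)$ be the completion of $\mathcal M$ for $\|x\|_1=\tau(|x|)$ (the predual of $\mathcal M$) and $L_2(\mathcal M)$ the completion for $\|x\|_2=\tau(x^*x)^{1/2}$. For a family $(f_i)_{i\in I}$ in $L_1(\mathcal M)$ put $$\|(f_i)_{i\in I}\|_{L_1[\ell_\infty]}=\inf\Big\{\|\alpha\|_2\,\sup_{i}\|h_i\|_\infty\,\|\beta\|_2\;:\; f_i=\alpha h_i\beta \text{ for all } i,\ \alpha,\beta\in L_2(\mathcal M),\ (h_i)_i \text{ bounded in } \mathcal M\Big\}\in[0,\infty],$$ and for a double sequence $(f_{n,m})$ in $L_1(\mathcal M)$ put $$\Big\|{\limsup_{n,m\to\infty}}^{+} f_{n,m}\Big\|_1=\sup_{\varepsilon>0}\ \inf_{e}\ \inf_{N,K}\ \big\|(e^\perp f_{n,m}e^\perp)_{n>N,\,m>K}\big\|_{L_1[\ell_\infty]},$$ where $e$ runs through the projections of $\mathcal M$ with $\tau(e)<\varepsilon$ and $e^\perp=1-e$. A sequence $f_n$ converges to $f$ bilaterally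 almost uniformly (b.a.u.) if for every $\varepsilon>0$ there is a projection $e\in\mathcal M$ with $\tau(e)<\varepsilon$ and $\|e^\perp(f_n-f)e^\perp\|_\infty\to0$. Let $\Phi:[0,\infty)\to[0,\infty)$ be convex and increasing with $\Phi(0)=0$ and $\lim_{t\to\infty}\Phi(t)=\infty$, and let $L_\Phi(\mathcal M)\subset L_1(\mathcal M)$ be the Orlicz space with norm $\|f\|_\Phi=\inf\{\lambda>0:\tau(\Phi(|f|/\lambda))\le1\}$. Let $(A_n)_{n}$ and $(B_m)_{m}$ be sequences of positivity-preserving linear maps on $L_1(\mathcal M)$ such that (i) $\|(B_m)_m: L_\Phi(\mathcal M)\to L_1(\mathcal M;\ell_\infty)\|<\infty$, this norm being the least constant $C$ with $\|(B_m(f))_m\|_{L_1[\ell_\infty]}\le C\|f\|_\Phi$ for all $f\in L_\Phi(\mathcal M)$; (ii) there is a bounded linear map $F: L_1(\mathcal M)\to L_1(\mathcal M)$ such that $A_n(f)\to F(f)$ b.a.u. for every $f\in L_1(\mathcal M)$. Then for every self-adjoint $f\in L_\Phi(\mathcal M)$, in particular for every $f\ge 0$ in $L_\Phi(\mathcal M)$,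 $$\Big\|{\limsup_{n,m\to\infty}}^{+} A_n\circ B_m(f)\Big\|_1\le\|F\|\;\big\|(B_m)_m:L_\Phi(\mathcal M)\to L_1(\mathcal M;\ell_\infty)\big\|\;\|f\|_\Phi ,$$ and for an arbitrary $f=g+ih\in L_\Phi(\mathcal M)$, where $g,h\in L_\Phi(\mathcal M)$ are its self-adjoint real and imaginary parts, the same inequality holds with $\|f\|_\Phi$ replaced by $\|g\|_\Phi+\|h\|_\Phi$. -/

import Mathlib

open scoped ENNReal NNReal ComplexOrder InnerProductSpace

noncomputable section

namespace NCIntegration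

universe u

/-! ## Concrete von Neumann algebras as C*-algebras -/

section Concrete

variable {H : Type u} [NormedAddCommGroup H] [InnerProductSpace ℂ H] [CompleteSpace H]

instance instSMulMemClass : SMulMemClass (VonNeumannAlgebra H) ℂ (H →L[ℂ] H) where
  smul_mem {S} c {_} hx := S.toStarSubalgebra.smul_mem hx c

instance instIsClosedCoe (S : VonNeumannAlgebra H) : IsClosed (S : Set (H →L[ℂ] H)) := by
  rw [← S.centralizer_centralizer]
  exact Set.isClosed_centralizer _

end Concrete

/-! ## Tracial states -/

/-- A tracial state on a unital C*-algebra. -/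
structure TracialState (M : Type u) [CStarAlgebra M] where
  /-- the underlying functional -/
  toFunctional : M →L[ℂ] ℂ
  nonneg' : ∀ x : M, 0 ≤ toFunctional (star x * x)
  one' : toFunctional 1 = 1
  comm' : ∀ x y : M, toFunctional (x * y) = toFunctional (y * x)

instance {M : Type u} [CStarAlgebra M] : CoeFun (TracialState M) (fun _ => M → ℂ) where
  coe τ := fun x => τ.toFunctional x

section General

variable {M : Type u} [CStarAlgebra M] (τ : TracialState M)

/-- The state is faithful. -/
def TracialState.IsFaithful : Prop := ∀ x : M, τ (star x * x) = 0 → x = 0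

/-- A functional `τ` on a von Neumann algebra `S` on `H` is normal if it is weak-* continuous,
i.e. if it is the restriction of a functional given by a trace class operator
`∑ᵢ |ηᵢ⟩⟨ξᵢ|` with `∑ ‖ξᵢ‖² < ∞` and `∑ ‖ηᵢ‖² < ∞`. -/
def TracialState.IsNormal {H : Type u} [NormedAddCommGroup H] [InnerProductSpace ℂ H]
    [CompleteSpace H] {S : VonNeumannAlgebra H} (τ : TracialState S) : Prop :=
  ∃ ξ η : ℕ → H, (Summable fun i => ‖ξ i‖ ^ 2) ∧ (Summable fun i => ‖η i‖ ^ 2) ∧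
    ∀ x : S, HasSum (fun i => ⟪ξ i, (x : H →L[ℂ] H) (η i)⟫_ℂ) (τ x)

/-! ## The space `L₂(M, τ)` -/

lemma TracialState.map_star (x : M) : τ (star x) = star (τ x) := by
  let _ := CStarAlgebra.spectralOrder M
  let _ := CStarAlgebra.spectralOrderedRing M
  let g : M →ₚ[ℂ] ℂ := PositiveLinearMap.mk₀ (τ.toFunctional : M →ₗ[ℂ] ℂ) (by
    intro a ha
    obtain ⟨b, rfl⟩ := CStarAlgebra.nonneg_iff_eq_star_mul_self.mp ha
    exact τ.nonneg' b)
  exact StarHomClass.map_star g x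

lemma TracialState.conj_bound (a x : M) :
    (τ (star (a * x) * (a * x))).re ≤ ‖a‖ ^ 2 * (τ (star x * x)).re := by
  let _ := CStarAlgebra.spectralOrder M
  let _ := CStarAlgebra.spectralOrderedRing M
  have h : star x * (star a * a) * x ≤ ‖star a * a‖ • (star x * x) :=
    CStarAlgebra.star_left_conjugate_le_norm_smul
  rw [← sub_nonneg] at h
  obtain ⟨b, hb⟩ := CStarAlgebra.nonneg_iff_eq_star_mul_self.mp h
  have h2 := τ.nonneg' b
  rw [← hb, map_sub, CStarRing.norm_star_mul_self, ← Complex.coe_smul, map_smul] at h2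
  have h3 := (Complex.le_def.mp h2).1
  simp only [Complex.zero_re, Complex.sub_re, smul_eq_mul, Complex.re_ofReal_mul] at h3
  have h4 : star (a * x) * (a * x) = star x * (star a * a) * x := by
    simp [mul_assoc]
  rw [h4]
  nlinarith

/-- A copy of `M`, to be equipped with the inner product `⟪a, b⟫ = τ (a* b)`. -/
def PreL2 (_τ : TracialState M) : Type u := M

instance : AddCommGroup (PreL2 τ) := inferInstanceAs (AddCommGroup M)
instance : Module ℂ (PreL2 τ) := inferInstanceAs (Module ℂ M)

/-- The identity map from `M` to `PreL2 τ`. -/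
def toPreL2 : M ≃ₗ[ℂ] PreL2 τ := LinearEquiv.refl ℂ M

/-- The inner product `⟪a, b⟫ = τ (a* b)`. -/
abbrev preL2Core : PreInnerProductSpace.Core ℂ (PreL2 τ) where
  inner a b := τ (star ((toPreL2 τ).symm a) * (toPreL2 τ).symm b)
  conj_inner_symm a b := by
    rw [← Complex.star_def, ← τ.map_star]
    simp
  re_inner_nonneg a := (Complex.le_def.mp (τ.nonneg' _)).1
  add_left a b c := by simp [add_mul]
  smul_left a b r := by simp

instance : SeminormedAddCommGroup (PreL2 τ) :=
  InnerProductSpace.Core.toSeminormedAddCommGroup (c := preL2Core τ)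

instance : InnerProductSpace ℂ (PreL2 τ) := InnerProductSpace.ofCore (preL2Core τ)

lemma preL2_norm (a : M) : ‖toPreL2 τ a‖ = √(τ (star a * a)).re := rfl

/-- `L₂(M, τ)`: the completion of `M` for the norm `‖a‖₂ = τ (a* a)^(1/2)`. -/
abbrev L2 : Type u := UniformSpace.Completion (PreL2 τ)

/-- Left multiplication by `a ∈ M` on the dense subspace `M` of `L₂(M, τ)`. -/
def preLeftMul (a : M) : PreL2 τ →L[ℂ] PreL2 τ :=
  (toPreL2 τ ∘ₗ LinearMap.mulLeft ℂ a ∘ₗ (toPreL2 τ).symm.toLinearMap : PreL2 τ →ₗ[ℂ] PreL2 τ)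
    |>.mkContinuous ‖a‖ fun x => by
      obtain ⟨x, rfl⟩ := (toPreL2 τ).surjective x
      simp only [LinearMap.coe_comp, LinearEquiv.coe_coe, Function.comp_apply,
        LinearEquiv.symm_apply_apply, LinearMap.mulLeft_apply, preL2_norm]
      rw [← Real.sqrt_sq (norm_nonneg a), ← Real.sqrt_mul (sq_nonneg _)]
      exact Real.sqrt_le_sqrt (τ.conj_bound a x)

/-- Right multiplication by `a ∈ M` on the dense subspace `M` of `L₂(M, τ)`. -/
def preRightMul (a : M) : PreL2 τ →L[ℂ] PreL2 τ :=
  (toPreL2 τ ∘ₗ LinearMap.mulRight ℂ a ∘ₗ (toPreL2 τ).symm.toLinearMap : PreL2 τ →ₗ[ℂ] PreL2 τ)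
    |>.mkContinuous ‖a‖ fun x => by
      obtain ⟨x, rfl⟩ := (toPreL2 τ).surjective x
      simp only [LinearMap.coe_comp, LinearEquiv.coe_coe, Function.comp_apply,
        LinearEquiv.symm_apply_apply, LinearMap.mulRight_apply, preL2_norm]
      rw [← Real.sqrt_sq (norm_nonneg a), ← Real.sqrt_mul (sq_nonneg _)]
      have h := τ.conj_bound (star a) (star x)
      have h1 := τ.comm' (x * a) (star (x * a))
      have h2 := τ.comm' x (star x)
      rw [← star_mul, star_star, star_star, norm_star] at h
      rw [← h1, ← h2]
      exact Real.sqrt_le_sqrt h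

/-- Left multiplication by `a ∈ M` on `L₂(M, τ)`. -/
def leftMul (a : M) : L2 τ →L[ℂ] L2 τ := (preLeftMul τ a).completion

/-- Right multiplication by `a ∈ M` on `L₂(M, τ)`. -/
def rightMul (a : M) : L2 τ →L[ℂ] L2 τ := (preRightMul τ a).completion

/-! ## The space `L₁(M, τ)` -/

/-- The embedding of `M` into its dual, `z ↦ τ (z ·)`.  The norm of `τ (z ·)` is `τ (|z|)`. -/
def embed : M →ₗ[ℂ] StrongDual ℂ M where
  toFun z := τ.toFunctional ∘L ContinuousLinearMap.mul ℂ M z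
  map_add' y z := by ext x; simp
  map_smul' c z := by ext x; simp

/-- `L₁(M, τ)`: the completion of `M` for the norm `‖z‖₁ = τ (|z|)`, realized as the closure of
`M` in its dual space, `z ∈ M` being identified with the functional `τ (z ·)`.  It is the predual
of `M`; the element `f` of `L₁(M, τ)` is the functional `x ↦ τ (f x)`. -/
def L1 : Type u := (LinearMap.range (embed τ)).topologicalClosure

instance : NormedAddCommGroup (L1 τ) :=
  inferInstanceAs (NormedAddCommGroup (LinearMap.range (embed τ)).topologicalClosure)

instance : NormedSpace ℂ (L1 τ) :=
  inferInstanceAs (NormedSpace ℂ (LinearMap.range (embed τ)).topologicalClosure)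

/-- The isometric inclusion of `L₁(M, τ)` into the dual of `M`. -/
def L1.functional : L1 τ →ₗᵢ[ℂ] StrongDual ℂ M :=
  (LinearMap.range (embed τ)).topologicalClosure.subtypeₗᵢ

variable {τ} in
/-- The functional `x ↦ τ (f x)` given by `f ∈ L₁(M, τ)`. -/
def L1.toDual (f : L1 τ) : StrongDual ℂ M := L1.functional τ f

/-- Positivity of a functional. -/
def IsPos (f : StrongDual ℂ M) : Prop := ∀ x : M, 0 ≤ f (star x * x)

variable {τ} in
/-- Self-adjointness of an element of `L₁(M, τ)`. -/
def L1.IsSA (f : L1 τ) : Prop := ∀ x : M, f.toDual (star x) = star (f.toDual x)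

/-- A linear map on `L₁(M, τ)` is positivity preserving. -/
def IsPositivityPreserving (T : L1 τ →ₗ[ℂ] L1 τ) : Prop :=
  ∀ f : L1 τ, IsPos f.toDual → IsPos (T f).toDual

/-- The compression `p f p`, i.e. the functional `x ↦ τ (p f p x) = τ (f p x p)`. -/
def compress (p : M) (f : StrongDual ℂ M) : StrongDual ℂ M :=
  f ∘L ContinuousLinearMap.mulLeftRight ℂ M p p

/-- The norm `‖f‖_∞ ∈ [0, ∞]`, infinite if `f` does not belong to `M`. -/
def normInfty (f : StrongDual ℂ M) : ℝ≥0∞ := ⨅ (z : M) (_ : f = embed τ z), ‖z‖ₑ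

/-! ## Orlicz spaces -/

/-- A convex increasing function on `[0, ∞)` with `Φ(0) = 0` and `Φ(∞) = ∞`
(the values of `Φ` on the negative numbers play no role). -/
structure IsOrlicz (Φ : ℝ → ℝ) : Prop where
  convexOn : ConvexOn ℝ (Set.Ici 0) Φ
  monotoneOn : MonotoneOn Φ (Set.Ici 0)
  map_zero : Φ 0 = 0
  tendsto : Filter.Tendsto Φ Filter.atTop Filter.atTop

/-- `ρ = |f|`: `ρ` is positive and there is a partial isometry `w ∈ M` with `f = w ρ` and
`ρ = w* f`. -/
def IsModulus (f ρ : L1 τ) : Prop :=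
  IsPos ρ.toDual ∧ ∃ w : M, w * star w * w = w ∧
    ∀ x : M, f.toDual x = ρ.toDual (x * w) ∧
      ρ.toDual x = f.toDual (x * star w)

/-- `τ (Ψ(|f|)) ∈ [0, ∞]` for increasing continuous `Ψ : [0, ∞) → [0, ∞)` with `Ψ(0) = 0`: the
supremum of the numbers `τ (Ψ(a))`, where `a` runs through the `a ∈ M` with `0 ≤ a ≤ |f|`. -/
def traceOfModulus (Ψ : ℝ → ℝ) (f : L1 τ) : ℝ≥0∞ :=
  ⨆ (ρ : L1 τ) (_ : IsModulus τ f ρ) (a : M) (_ : ∃ b : M, a = star b * b)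
    (_ : IsPos (ρ.toDual - embed τ a)), ENNReal.ofReal (τ (cfc Ψ a)).re

/-- The Luxemburg norm `‖f‖_Φ = inf {c > 0 : τ (Φ(|f| / c)) ≤ 1} ∈ [0, ∞]`.  The Orlicz space
`L_Φ(M, τ)`, which is contained in `L₁(M, τ)`, consists of the `f` with `‖f‖_Φ < ∞`. -/
def orliczNorm (Φ : ℝ → ℝ) (f : L1 τ) : ℝ≥0∞ :=
  ⨅ (c : ℝ) (_ : 0 < c) (_ : traceOfModulus τ (fun t => Φ (t / c)) f ≤ 1), ENNReal.ofReal c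

/-! ## Maximal norms -/

/-- The norm in `L₁(M; ℓ_∞(ι))`: the infimum of `‖α‖₂ (sup ‖hᵢ‖) ‖β‖₂` over all factorizations
`fᵢ = α hᵢ β` with `α, β ∈ L₂(M, τ)` and `(hᵢ)` bounded in `M`; it is infinite if there is no such
factorization.  The functional `α h β` is
`x ↦ τ (α h β x) = ⟪α*, h (β x)⟫`, and `a` below stands for `α*`, with `‖α*‖₂ = ‖α‖₂`. -/
def maxNorm {ι : Type*} (f : ι → StrongDual ℂ M) : ℝ≥0∞ :=
  ⨅ (a : L2 τ) (b : L2 τ) (h : ι → M) (_ : BddAbove (Set.range fun i => ‖h i‖))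
    (_ : ∀ i x, f i x = ⟪a, leftMul τ (h i) (rightMul τ x b)⟫_ℂ),
    ‖a‖ₑ * (⨆ i, ‖h i‖ₑ) * ‖b‖ₑ

/-- The norm of `(B_m)_m : L_Φ(M) → L₁(M; ℓ_∞)`. -/
def maxOpNorm (Φ : ℝ → ℝ) (B : ℕ → L1 τ →ₗ[ℂ] L1 τ) : ℝ≥0∞ :=
  sInf {C : ℝ≥0∞ | ∀ f : L1 τ, orliczNorm τ Φ f < ∞ →
    maxNorm τ (fun m => (B m f).toDual) ≤ C * orliczNorm τ Φ f}

/-! ## Bilateral almost uniform convergence and the noncommutative limsup -/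

/-- `f_n → g` bilaterally almost uniformly. -/
def TendstoBAU (f : ℕ → L1 τ) (g : L1 τ) : Prop :=
  ∀ ε : ℝ, 0 < ε → ∃ e : M, IsStarProjection e ∧ (τ e).re < ε ∧
    Filter.Tendsto (fun n => normInfty τ (compress (1 - e) ((f n).toDual - g.toDual)))
      Filter.atTop (nhds 0)

/-- `‖limsup⁺_{n,m → ∞} f_{n,m}‖₁ =
sup_{ε > 0} inf_{τ(e) < ε} inf_{N,K} ‖((1 - e) f_{n,m} (1 - e))_{n > N, m > K}‖_{L₁(M; ℓ_∞)}`. -/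
def limsupNorm (f : ℕ → ℕ → L1 τ) : ℝ≥0∞ :=
  ⨆ (ε : ℝ) (_ : 0 < ε), ⨅ (e : M) (_ : IsStarProjection e) (_ : (τ e).re < ε)
    (N : ℕ) (K : ℕ), maxNorm τ (fun i : Set.Ioi N × Set.Ioi K =>
      compress (1 - e) (f i.1 i.2).toDual)

end General

end NCIntegration

end

/-! Let `f` be self-adjoint and factor `B m f = α (h m) β` almost optimally. The Cauchy–Schwarz and
arithmetic-geometric mean inequalities turn the factorization into one `g` in `L₁` with `-g ≤ B m f
≤ g` for all `m` and `‖g‖₁ ≤ ‖α‖₂ sup ‖h m‖ ‖β‖₂` (`exists_majorant_of_maxNorm_lt`). Positivity of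
`A n` gives `-A n g ≤ A n (B m f) ≤ A n g`, so the double sequence is controlled by the single
sequence `A n g`, which tends b.a.u. to `F g`. Away from a small projection and for large `n`, the
compression of `A n g` lies below that of `F g` plus a small multiple of `1`, hence below some `ξ*
ξ` with `‖ξ‖₂²` close to `‖F g‖₁` (`exists_vector_eventually_majorant`).

It remains to return from order to factorization: a functional dominated by `ξ* ξ` has the form `ξ*
h ξ` with a contraction `h` in `M` (`exists_eq_inner_leftMul`), which bounds the maximal norm by
`‖ξ‖₂²`. This Radon–Nikodym step first yields an operator commuting with right multiplications. That
operator is a left multiplication by the commutant theorem `exists_leftMul_eq`, which rests on the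
duality of `L₁` and `M`, `exists_eq_trace_mul`.

For complex `f`, order bounds are replaced by the Cauchy–Schwarz form of domination, `IsDominated`,
which passes to sums and is unaffected by the factor `i`. -/

noncomputable section

namespace NCIntegration

universe u

/-! ### The right and left module structure of `L₂` and its vector functionals. -/

section HilbertSpace

variable {M : Type u} [CStarAlgebra M] (τ : TracialState M)

/-- The canonical map from `M` to `L₂(M, τ)`. -/
def toL2 : M →ₗ[ℂ] L2 τ :=
  (UniformSpace.Completion.toComplL : PreL2 τ →L[ℂ] L2 τ).toLinearMap ∘ₗ (toPreL2 τ).toLinearMap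

lemma toL2_apply (x : M) : toL2 τ x = ((toPreL2 τ x : PreL2 τ) : L2 τ) := rfl

lemma inner_toL2 (x y : M) : ⟪toL2 τ x, toL2 τ y⟫_ℂ = τ.toFunctional (star x * y) := by
  rw [toL2_apply, toL2_apply, UniformSpace.Completion.inner_coe]
  rfl

lemma norm_sq_toL2 (x : M) : ‖toL2 τ x‖ ^ 2 = (τ.toFunctional (star x * x)).re := by
  rw [← inner_toL2, ← inner_self_eq_norm_sq (𝕜 := ℂ)]
  rfl

lemma norm_toL2_star (x : M) : ‖toL2 τ (star x)‖ = ‖toL2 τ x‖ := by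
  rw [← sq_eq_sq₀ (norm_nonneg _) (norm_nonneg _), norm_sq_toL2, norm_sq_toL2, star_star,
    τ.comm']

lemma norm_toL2_one : ‖toL2 τ (1 : M)‖ = 1 := by
  rw [← sq_eq_sq₀ (norm_nonneg _) zero_le_one, norm_sq_toL2, star_one, one_mul, τ.one']
  simp

lemma denseRange_toL2 : DenseRange (toL2 τ) :=
  UniformSpace.Completion.denseRange_coe.comp (toPreL2 τ).surjective.denseRange
    (UniformSpace.Completion.continuous_coe _)

variable {τ} in
lemma L2.induction_on {p : L2 τ → Prop} (ξ : L2 τ) (hp : IsClosed {ξ | p ξ})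
    (h : ∀ x : M, p (toL2 τ x)) : p ξ :=
  (denseRange_toL2 τ).induction_on ξ hp h

lemma rightMul_toL2 (x y : M) : rightMul τ x (toL2 τ y) = toL2 τ (y * x) := by
  rw [rightMul, toL2_apply, ContinuousLinearMap.completion_apply_coe]
  rfl

lemma leftMul_toL2 (x y : M) : leftMul τ x (toL2 τ y) = toL2 τ (x * y) := by
  rw [leftMul, toL2_apply, ContinuousLinearMap.completion_apply_coe]
  rfl

lemma norm_toL2_mul_le (x y : M) : ‖toL2 τ (x * y)‖ ≤ ‖x‖ * ‖toL2 τ y‖ := by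
  rw [← sq_le_sq₀ (norm_nonneg _) (by positivity), mul_pow, norm_sq_toL2, norm_sq_toL2]
  exact τ.conj_bound x y

lemma norm_rightMul_apply_le (x : M) (ξ : L2 τ) : ‖rightMul τ x ξ‖ ≤ ‖x‖ * ‖ξ‖ := by
  induction ξ using L2.induction_on with
  | hp => exact isClosed_le (by fun_prop) (by fun_prop)
  | h y =>
    have h := norm_toL2_mul_le τ (star x) (star y)
    rwa [← star_mul, norm_toL2_star, norm_toL2_star, norm_star, ← rightMul_toL2] at h

lemma norm_toL2_le (x : M) : ‖toL2 τ x‖ ≤ ‖x‖ := by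
  simpa [norm_toL2_one] using norm_toL2_mul_le τ x 1

lemma rightMul_mul (x y : M) (ξ : L2 τ) :
    rightMul τ (x * y) ξ = rightMul τ y (rightMul τ x ξ) := by
  induction ξ using L2.induction_on with
  | hp => exact isClosed_eq (by fun_prop) (by fun_prop)
  | h z => simp [rightMul_toL2, mul_assoc]

lemma rightMul_one (ξ : L2 τ) : rightMul τ 1 ξ = ξ := by
  induction ξ using L2.induction_on with
  | hp => exact isClosed_eq (by fun_prop) (by fun_prop)
  | h z => simp [rightMul_toL2]

lemma leftMul_rightMul (x y : M) (ξ : L2 τ) :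
    leftMul τ x (rightMul τ y ξ) = rightMul τ y (leftMul τ x ξ) := by
  induction ξ using L2.induction_on with
  | hp => exact isClosed_eq (by fun_prop) (by fun_prop)
  | h z => simp [rightMul_toL2, leftMul_toL2, mul_assoc]

lemma inner_rightMul_left (x : M) (ξ η : L2 τ) :
    ⟪rightMul τ x ξ, η⟫_ℂ = ⟪ξ, rightMul τ (star x) η⟫_ℂ := by
  induction ξ using L2.induction_on with
  | hp => exact isClosed_eq (by fun_prop) (by fun_prop)
  | h y =>
    induction η using L2.induction_on with
    | hp => exact isClosed_eq (by fun_prop) (by fun_prop)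
    | h z =>
      rw [rightMul_toL2, rightMul_toL2, inner_toL2, inner_toL2, star_mul, mul_assoc, τ.comm',
        mul_assoc]

lemma inner_rightMul_right (x : M) (ξ η : L2 τ) :
    ⟪ξ, rightMul τ x η⟫_ℂ = ⟪rightMul τ (star x) ξ, η⟫_ℂ := by
  rw [inner_rightMul_left, star_star]

lemma rightMul_add (x y : M) : rightMul τ (x + y) = rightMul τ x + rightMul τ y := by
  ext ξ
  induction ξ using L2.induction_on with
  | hp => exact isClosed_eq (ContinuousLinearMap.continuous _) (ContinuousLinearMap.continuous _)
  | h z => simp [rightMul_toL2, mul_add]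

lemma rightMul_smul (c : ℂ) (x : M) : rightMul τ (c • x) = c • rightMul τ x := by
  ext ξ
  induction ξ using L2.induction_on with
  | hp => exact isClosed_eq (ContinuousLinearMap.continuous _) (ContinuousLinearMap.continuous _)
  | h z => simp [rightMul_toL2]

/-- Right multiplication, as a bounded linear map from `M` to the operators on `L₂(M, τ)`. -/
def rightMulCLM : M →L[ℂ] L2 τ →L[ℂ] L2 τ :=
  LinearMap.mkContinuous
    { toFun := rightMul τ
      map_add' := rightMul_add τ
      map_smul' := rightMul_smul τ } 1 fun x => by
    rw [one_mul]
    exact ContinuousLinearMap.opNorm_le_bound _ (norm_nonneg x) (norm_rightMul_apply_le τ x)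

/-- The functional `x ↦ ⟪ξ, ξ x⟫` on `M`, that is, `ξ* ξ ∈ L₁(M, τ)`. -/
def vectorFunctional (ξ : L2 τ) : StrongDual ℂ M :=
  innerSL ℂ ξ ∘L (rightMulCLM τ).flip ξ

lemma vectorFunctional_apply (ξ : L2 τ) (x : M) :
    vectorFunctional τ ξ x = ⟪ξ, rightMul τ x ξ⟫_ℂ := rfl

lemma vectorFunctional_toL2 (x : M) :
    vectorFunctional τ (toL2 τ x) = embed τ (star x * x) := by
  ext y
  rw [vectorFunctional_apply, rightMul_toL2, inner_toL2, ← mul_assoc]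
  rfl

lemma vectorFunctional_star_mul_self (ξ : L2 τ) (x : M) :
    vectorFunctional τ ξ (star x * x) = ((‖rightMul τ (star x) ξ‖ ^ 2 : ℝ) : ℂ) := by
  rw [vectorFunctional_apply, rightMul_mul, inner_rightMul_right, inner_self_eq_norm_sq_to_K]
  simp

lemma continuous_vectorFunctional : Continuous (vectorFunctional τ) := by
  unfold vectorFunctional
  fun_prop

lemma norm_vectorFunctional_le (ξ : L2 τ) : ‖vectorFunctional τ ξ‖ ≤ ‖ξ‖ ^ 2 :=
  ContinuousLinearMap.opNorm_le_bound _ (by positivity) fun x => by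
    rw [vectorFunctional_apply]
    calc ‖⟪ξ, rightMul τ x ξ⟫_ℂ‖ ≤ ‖ξ‖ * ‖rightMul τ x ξ‖ := norm_inner_le_norm _ _
      _ ≤ ‖ξ‖ * (‖x‖ * ‖ξ‖) := by gcongr; exact norm_rightMul_apply_le τ x ξ
      _ = ‖ξ‖ ^ 2 * ‖x‖ := by ring

lemma vectorFunctional_mem (ξ : L2 τ) :
    vectorFunctional τ ξ ∈ (LinearMap.range (embed τ)).topologicalClosure := by
  induction ξ using L2.induction_on with
  | hp => exact (Submodule.isClosed_topologicalClosure _).preimage (continuous_vectorFunctional τ)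
  | h x =>
    rw [vectorFunctional_toL2]
    exact Submodule.le_topologicalClosure _ (LinearMap.mem_range_self _ _)

lemma L1.exists_toDual_eq {u : StrongDual ℂ M}
    (hu : u ∈ (LinearMap.range (embed τ)).topologicalClosure) : ∃ f : L1 τ, f.toDual = u :=
  ⟨⟨u, hu⟩, rfl⟩

lemma L1.toDual_mem (f : L1 τ) :
    f.toDual ∈ (LinearMap.range (embed τ)).topologicalClosure :=
  Subtype.property (p := (· ∈ (LinearMap.range (embed τ)).topologicalClosure)) f

lemma L1.norm_toDual (f : L1 τ) : ‖f.toDual‖ = ‖f‖ := (L1.functional τ).norm_map f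

lemma L1.toDual_add (f g : L1 τ) : (f + g).toDual = f.toDual + g.toDual :=
  map_add (L1.functional τ) f g

lemma L1.toDual_sub (f g : L1 τ) : (f - g).toDual = f.toDual - g.toDual :=
  map_sub (L1.functional τ) f g

lemma L1.toDual_smul (c : ℂ) (f : L1 τ) : (c • f).toDual = c • f.toDual :=
  map_smul (L1.functional τ) c f

end HilbertSpace

/-! ### Trace estimates by continuous functional calculus. -/

section Trace

variable {M : Type u} [CStarAlgebra M] (τ : TracialState M)

lemma embed_apply (z x : M) : embed τ z x = τ.toFunctional (z * x) := rfl

lemma TracialState.re_sub_algebraMap (x : M) (r : ℝ) :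
    (τ.toFunctional (x - algebraMap ℝ M r)).re = (τ.toFunctional x).re - r := by
  rw [map_sub, Algebra.algebraMap_eq_smul_one, ← Complex.coe_smul, map_smul, τ.one']
  simp

section Order

variable [PartialOrder M] [StarOrderedRing M]

lemma TracialState.re_nonneg {x : M} (hx : 0 ≤ x) : 0 ≤ (τ.toFunctional x).re := by
  obtain ⟨y, rfl⟩ := CStarAlgebra.nonneg_iff_eq_star_mul_self.mp hx
  exact (Complex.le_def.mp (τ.nonneg' y)).1

lemma TracialState.re_mono {x y : M} (h : x ≤ y) :
    (τ.toFunctional x).re ≤ (τ.toFunctional y).re := by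
  have := τ.re_nonneg (sub_nonneg.mpr h)
  rw [map_sub, Complex.sub_re] at this
  linarith

/-- Test `τ (w ·)` against the sign of `w`. The sign is replaced by the continuous function `t /
(|t| + ε)`, which costs at most `ε` because `t² / (|t| + ε) ≥ max t 0 - ε`. -/
lemma re_trace_posPart_le {w : M} (hw : IsSelfAdjoint w) :
    (τ.toFunctional (cfc (fun t : ℝ => max t 0) w)).re ≤ ‖embed τ w‖ := by
  refine le_of_forall_pos_le_add fun ε hε => ?_
  have hpos : ∀ t : ℝ, 0 < |t| + ε := fun t => by positivity
  have hcont : Continuous fun t : ℝ => t / (|t| + ε) :=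
    continuous_id.div (by fun_prop) fun t => (hpos t).ne'
  set v : M := cfc (fun t : ℝ => t / (|t| + ε)) w with hv
  have hnorm : ‖v‖ ≤ 1 := by
    refine norm_cfc_le zero_le_one fun t _ => ?_
    rw [Real.norm_eq_abs, abs_div, abs_of_pos (hpos t), div_le_one (hpos t)]
    linarith
  have hmul : w * v = cfc (fun t : ℝ => t * (t / (|t| + ε))) w := by
    rw [cfc_mul (fun t : ℝ => t) _ w (by fun_prop) hcont.continuousOn, cfc_id' ℝ w]
  have hle : cfc (fun t : ℝ => max t 0) w - algebraMap ℝ M ε ≤ w * v := by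
    rw [hmul, ← cfc_const ε w, ← cfc_sub (fun t : ℝ => max t 0) _ w (by fun_prop) (by fun_prop)]
    refine cfc_mono (fun t _ => ?_) (by fun_prop) (continuous_id.mul hcont).continuousOn
    rw [← mul_div_assoc, le_div_iff₀ (hpos t)]
    rcases le_total 0 t with h | h
    · rw [max_eq_left h, abs_of_nonneg h]
      nlinarith
    · rw [max_eq_right h, abs_of_nonpos h]
      nlinarith
  have h1 := τ.re_mono hle
  rw [τ.re_sub_algebraMap] at h1
  have h2 : (τ.toFunctional (w * v)).re ≤ ‖embed τ w‖ :=
    calc (τ.toFunctional (w * v)).re ≤ ‖embed τ w v‖ := Complex.re_le_norm _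
      _ ≤ ‖embed τ w‖ * ‖v‖ := (embed τ w).le_opNorm v
      _ ≤ ‖embed τ w‖ * 1 := by gcongr
      _ = ‖embed τ w‖ := mul_one _
  linarith

end Order

/-- The model is the polar decomposition, `z = (u |z|^(1/2)) |z|^(1/2)`. Regularizing `|z|` to `(z*
z + ε²)^(1/2)` makes the right factor invertible, so the factorization stays within continuous
functional calculus. -/
lemma exists_eq_mul_norm_sq_le (z : M) {ε : ℝ} (hε : 0 < ε) :
    ∃ x y : M, z = x * y ∧ ‖toL2 τ x‖ ^ 2 ≤ ‖embed τ z‖ + ε ∧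
      ‖toL2 τ y‖ ^ 2 ≤ ‖embed τ z‖ + ε := by
  let _ := CStarAlgebra.spectralOrder M
  let _ := CStarAlgebra.spectralOrderedRing M
  set a : M := star z * z with ha
  have hasa : IsSelfAdjoint a := .star_mul_self z
  have ha0 : 0 ≤ a := star_mul_self_nonneg z
  have hspec : ∀ t ∈ spectrum ℝ a, 0 ≤ t := fun t ht => spectrum_nonneg_of_nonneg ha0 ht
  -- The fourth root appears because `a = |z|²` and `y` stands for `|z|^(1/2)`; then `q² ≥ ε`, which
  -- is what `hle2` needs.
  set q : ℝ → ℝ := fun t => √(√(|t| + ε ^ 2)) with hq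
  have hqc : Continuous q := by fun_prop
  have hqpos : ∀ t, 0 < q t := fun t => by simp only [hq]; positivity
  have hq2 : ∀ t, q t * q t = √(|t| + ε ^ 2) := fun t => Real.mul_self_sqrt (by positivity)
  have hq4 : ∀ t, (q t * q t) * (q t * q t) = |t| + ε ^ 2 := fun t => by
    rw [hq2]; exact Real.mul_self_sqrt (by positivity)
  have hqε : ∀ t, ε ≤ q t * q t := fun t => by
    rw [hq2]; exact Real.le_sqrt_of_sq_le (by linarith [abs_nonneg t])
  have hqi : Continuous fun t => (q t)⁻¹ := hqc.inv₀ fun t => (hqpos t).ne'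
  have hqi1 : Continuous fun t => (q t)⁻¹ * t := hqi.mul continuous_id
  have hqi2 : Continuous fun t => (q t)⁻¹ * t * (q t)⁻¹ := hqi1.mul hqi
  have hqi3 : Continuous fun t => (q t)⁻¹ * ((q t)⁻¹ * t * (q t)⁻¹) := hqi.mul hqi2
  set y : M := cfc q a with hy
  set yi : M := cfc (fun t => (q t)⁻¹) a with hyi
  have hysa : star y = y := (cfc_predicate q a : IsSelfAdjoint y)
  have hyisa : star yi = yi := (cfc_predicate (fun t => (q t)⁻¹) a : IsSelfAdjoint yi)
  have hyy : yi * y = 1 := by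
    rw [hy, hyi, ← cfc_mul _ _ a hqi.continuousOn hqc.continuousOn]
    simp only [inv_mul_cancel₀ (hqpos _).ne']
    exact cfc_const_one ℝ a
  have hsq : star y * y = cfc (fun t => q t * q t) a := by
    rw [hysa, hy, ← cfc_mul _ _ a hqc.continuousOn hqc.continuousOn]
  have hmid : yi * a * yi = cfc (fun t => (q t)⁻¹ * t * (q t)⁻¹) a := by
    rw [cfc_mul _ _ a hqi1.continuousOn hqi.continuousOn,
      cfc_mul _ (fun t : ℝ => t) a hqi.continuousOn (by fun_prop), cfc_id' ℝ a]
  have hle2 : star y * y - algebraMap ℝ M ε ≤ yi * a * yi := by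
    rw [hmid, hsq, ← cfc_const ε a, 
      ← cfc_sub (fun t => q t * q t) _ a (hqc.mul hqc).continuousOn (by fun_prop)]
    refine cfc_mono (fun t ht => ?_) ((hqc.mul hqc).sub continuous_const).continuousOn
      hqi2.continuousOn
    have h0 := hspec t ht
    have h4 := hq4 t
    rw [abs_of_nonneg h0] at h4
    rw [mul_comm (q t)⁻¹ t, mul_assoc, ← mul_inv, ← div_eq_mul_inv,
      le_div_iff₀ (mul_pos (hqpos t) (hqpos t)), sub_mul, h4]
    nlinarith [hqε t]
  -- A regularized adjoint of the polar part `u`: it is a contraction, and testing `τ (z ·)` on it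
  -- gives `τ (yi * a * yi) = ‖z * yi‖₂²`.
  set w : M := yi * yi * star z with hw
  have hwnorm : ‖w‖ ≤ 1 := by
    have h1 : w * star w = cfc (fun t => (q t)⁻¹ * ((q t)⁻¹ * t * (q t)⁻¹) * (q t)⁻¹) a := by
      rw [cfc_mul _ _ a hqi3.continuousOn
        hqi.continuousOn, cfc_mul _ _ a hqi.continuousOn
        hqi2.continuousOn, ← hmid, ← hyi, hw, star_mul, star_mul,
        star_star, hyisa, ha]
      simp only [mul_assoc]
    have h2 : ‖w * star w‖ ≤ 1 := by
      rw [h1]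
      refine norm_cfc_le zero_le_one fun t ht => ?_
      have h0 := hspec t ht
      have h4 := hq4 t
      rw [abs_of_nonneg h0] at h4
      have h5 : (q t)⁻¹ * ((q t)⁻¹ * t * (q t)⁻¹) * (q t)⁻¹ = t / (t + ε ^ 2) := by
        rw [← h4]
        field_simp
      rw [h5, Real.norm_eq_abs, abs_of_nonneg (by positivity), div_le_one (by positivity)]
      linarith [sq_nonneg ε]
    rw [CStarRing.norm_self_mul_star] at h2
    nlinarith [norm_nonneg w]
  have htr : τ.toFunctional (z * w) = τ.toFunctional (yi * a * yi) := by
    rw [τ.comm' z w, hw, ha, τ.comm' (yi * (star z * z)) yi]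
    simp only [mul_assoc]
  have hz : (τ.toFunctional (yi * a * yi)).re ≤ ‖embed τ z‖ :=
    calc (τ.toFunctional (yi * a * yi)).re ≤ ‖embed τ z w‖ := by
          rw [← htr]; exact Complex.re_le_norm _
      _ ≤ ‖embed τ z‖ * ‖w‖ := (embed τ z).le_opNorm w
      _ ≤ ‖embed τ z‖ * 1 := by gcongr
      _ = ‖embed τ z‖ := mul_one _
  have hyle : (τ.toFunctional (star y * y)).re ≤ ‖embed τ z‖ + ε := by
    have h1 := τ.re_mono hle2
    rw [τ.re_sub_algebraMap] at h1
    linarith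
  refine ⟨z * yi, y, by rw [mul_assoc, hyy, mul_one], ?_, ?_⟩
  · rw [norm_sq_toL2, star_mul, hyisa, mul_assoc, ← mul_assoc (star z), ← mul_assoc, ← ha]
    linarith
  · rwa [norm_sq_toL2]

end Trace

/-! ### Weak compactness of balls and the duality of `L₁` and `M`. -/

section Compactness

variable {H : Type u} [NormedAddCommGroup H] [InnerProductSpace ℂ H] [CompleteSpace H]

open Filter Topology

/-- The unit balls of the algebra of bounded operators are compact in the weak operator
topology. -/
lemma exists_weak_limit_of_ultrafilter {ι : Type*} (U : Ultrafilter ι) (T : ι → H →L[ℂ] H)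
    {C : ℝ} (hT : ∀ i, ‖T i‖ ≤ C) :
    ∃ T₀ : H →L[ℂ] H, ‖T₀‖ ≤ C ∧ ∀ ξ η, Tendsto (fun i => ⟪ξ, T i η⟫_ℂ) U (𝓝 ⟪ξ, T₀ η⟫_ℂ) := by
  have hbound : ∀ i ξ η, ‖⟪ξ, T i η⟫_ℂ‖ ≤ C * ‖ξ‖ * ‖η‖ := fun i ξ η =>
    calc ‖⟪ξ, T i η⟫_ℂ‖ ≤ ‖ξ‖ * ‖T i η‖ := norm_inner_le_norm _ _
      _ ≤ ‖ξ‖ * (C * ‖η‖) := by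
        gcongr
        exact (T i).le_of_opNorm_le (hT i) η
      _ = C * ‖ξ‖ * ‖η‖ := by ring
  obtain ⟨i₀⟩ : Nonempty ι := (U : Filter ι).nonempty_of_neBot
  have hC : 0 ≤ C := (norm_nonneg _).trans (hT i₀)
  have hlim : ∀ ξ η, ∃ c : ℂ, Tendsto (fun i => ⟪ξ, T i η⟫_ℂ) U (𝓝 c) := fun ξ η => by
    have hc := isCompact_closedBall (0 : ℂ) (C * ‖ξ‖ * ‖η‖)
    obtain ⟨c, -, hc⟩ := hc.ultrafilter_le_nhds (U.map fun i => ⟪ξ, T i η⟫_ℂ) (by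
      rw [le_principal_iff, Ultrafilter.coe_map, mem_map]
      exact univ_mem' fun i => by simpa using hbound i ξ η)
    exact ⟨c, hc⟩
  choose b hb using hlim
  let f : H →L⋆[ℂ] H →L[ℂ] ℂ := LinearMap.mkContinuous₂
    (LinearMap.mk₂'ₛₗ (starRingEnd ℂ) (RingHom.id ℂ) b
      (fun ξ ξ' η => tendsto_nhds_unique (hb _ _)
        (by simpa only [inner_add_left] using (hb ξ η).add (hb ξ' η)))
      (fun c ξ η => tendsto_nhds_unique (hb _ _)
        (by simpa only [inner_smul_left, smul_eq_mul] using (hb ξ η).const_mul _))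
      (fun ξ η η' => tendsto_nhds_unique (hb _ _)
        (by simpa only [map_add, inner_add_right] using (hb ξ η).add (hb ξ η')))
      (fun c ξ η => tendsto_nhds_unique (hb _ _)
        (by simpa only [map_smul, inner_smul_right, smul_eq_mul, RingHom.id_apply]
          using (hb ξ η).const_mul _)))
    C (fun ξ η => le_of_tendsto (hb ξ η).norm (Eventually.of_forall fun i => hbound i ξ η))
  let T₁ : H →L[ℂ] H := InnerProductSpace.continuousLinearMapOfBilin f
  have hT₁ : ∀ ξ η, ⟪T₁ ξ, η⟫_ℂ = b ξ η :=
    InnerProductSpace.continuousLinearMapOfBilin_apply f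
  refine ⟨T₁.adjoint, ?_, fun ξ η => ?_⟩
  · rw [LinearIsometryEquiv.norm_map]
    refine T₁.opNorm_le_bound hC fun ξ => ?_
    have h : ‖⟪T₁ ξ, T₁ ξ⟫_ℂ‖ ≤ C * ‖ξ‖ * ‖T₁ ξ‖ := by
      rw [hT₁]
      exact le_of_tendsto (hb _ _).norm (Eventually.of_forall fun i => hbound i _ _)
    rw [inner_self_eq_norm_sq_to_K, norm_pow, RCLike.norm_ofReal,
      abs_norm] at h
    by_contra! hlt
    nlinarith [norm_nonneg (T₁ ξ), norm_nonneg ξ, mul_nonneg hC (norm_nonneg ξ)]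
  · rw [ContinuousLinearMap.adjoint_inner_right, hT₁]
    exact hb ξ η

variable {S : VonNeumannAlgebra H}

lemma exists_weak_limit_mem (U : Ultrafilter S) {C : ℝ} (hU : ∀ᶠ h in (U : Filter S), ‖h‖ ≤ C) :
    ∃ h₀ : S, ‖h₀‖ ≤ C ∧
      ∀ ξ η, Tendsto (fun h : S => ⟪ξ, (h : H →L[ℂ] H) η⟫_ℂ) U
        (𝓝 ⟪ξ, (h₀ : H →L[ℂ] H) η⟫_ℂ) := by
  have hC : 0 ≤ C := by
    obtain ⟨h, hh⟩ := hU.exists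
    exact (norm_nonneg h).trans hh
  classical
  -- The bound holds only along `U`, so elements outside the ball are replaced by `0`; this does not
  -- affect the limit.
  obtain ⟨T, hTC, hT⟩ := exists_weak_limit_of_ultrafilter U
    (fun h : S => if ‖h‖ ≤ C then (h : H →L[ℂ] H) else 0) (C := C) (fun h => by
      split_ifs with hh
      · exact hh
      · simpa using hC)
  have hlim : ∀ ξ η, Tendsto (fun h : S => ⟪ξ, (h : H →L[ℂ] H) η⟫_ℂ) U (𝓝 ⟪ξ, T η⟫_ℂ) :=
    fun ξ η => (hT ξ η).congr' (hU.mono fun h hh => by simp only [if_pos hh])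
  -- Commuting with a fixed operator survives weak limits, and `S` is its own double commutant.
  have hmem : T ∈ S := by
    rw [← SetLike.mem_coe, ← S.centralizer_centralizer]
    intro y hy
    ext η
    refine ext_inner_left ℂ fun ξ => ?_
    have h1 := hlim (ContinuousLinearMap.adjoint y ξ) η
    have h2 := hlim ξ (y η)
    simp only [ContinuousLinearMap.adjoint_inner_left] at h1
    refine tendsto_nhds_unique h1 (h2.congr fun h => ?_)
    have h3 : (h : H →L[ℂ] H) (y η) = y ((h : H →L[ℂ] H) η) :=
      congrArg (fun A : H →L[ℂ] H => A η) (hy h h.2)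
    rw [h3]
  exact ⟨⟨T, hmem⟩, hTC, hlim⟩

/-- Normality writes `τ` as a summable series of vector functionals, so on bounded sets weak
operator convergence passes through the series by dominated convergence. -/
lemma TracialState.IsNormal.tendsto {τ : TracialState S} (hτ : τ.IsNormal) (U : Ultrafilter S)
    {C : ℝ} (hU : ∀ᶠ h in (U : Filter S), ‖h‖ ≤ C) {h₀ : S}
    (hlim : ∀ ξ η, Tendsto (fun h : S => ⟪ξ, (h : H →L[ℂ] H) η⟫_ℂ) U
      (𝓝 ⟪ξ, (h₀ : H →L[ℂ] H) η⟫_ℂ)) (x : S) :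
    Tendsto (fun h : S => τ.toFunctional (h * x)) U (𝓝 (τ.toFunctional (h₀ * x))) := by
  obtain ⟨ξ, η, hξ, hη, hsum⟩ := hτ
  have hC : 0 ≤ C := by
    obtain ⟨h, hh⟩ := hU.exists
    exact (norm_nonneg h).trans hh
  have key := tendsto_tsum_of_dominated_convergence (𝓕 := (U : Filter S))
    (f := fun (h : S) i => ⟪ξ i, (h : H →L[ℂ] H) ((x : H →L[ℂ] H) (η i))⟫_ℂ)
    (g := fun i => ⟪ξ i, (h₀ : H →L[ℂ] H) ((x : H →L[ℂ] H) (η i))⟫_ℂ)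
    (bound := fun i => C * ‖x‖ * (‖ξ i‖ ^ 2 + ‖η i‖ ^ 2)) ((hξ.add hη).mul_left _)
    (fun i => hlim _ _) (hU.mono fun h hh i =>
      calc ‖⟪ξ i, (h : H →L[ℂ] H) ((x : H →L[ℂ] H) (η i))⟫_ℂ‖
          ≤ ‖ξ i‖ * ‖(h : H →L[ℂ] H) ((x : H →L[ℂ] H) (η i))‖ := norm_inner_le_norm _ _
        _ ≤ ‖ξ i‖ * (C * (‖x‖ * ‖η i‖)) := by
          gcongr
          refine ((h : H →L[ℂ] H).le_of_opNorm_le hh _).trans ?_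
          gcongr
          exact (x : H →L[ℂ] H).le_opNorm _
        _ = C * ‖x‖ * (‖ξ i‖ * ‖η i‖) := by ring
        _ ≤ C * ‖x‖ * (‖ξ i‖ ^ 2 + ‖η i‖ ^ 2) := by
          gcongr
          nlinarith [sq_nonneg (‖ξ i‖ - ‖η i‖), sq_nonneg ‖ξ i‖, sq_nonneg ‖η i‖])
  have h1 : ∀ h : S, ∑' i, ⟪ξ i, (h : H →L[ℂ] H) ((x : H →L[ℂ] H) (η i))⟫_ℂ =
      τ.toFunctional (h * x) := fun h => (hsum (h * x)).tsum_eq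
  simpa only [h1] using key

/-- The dual of `L₁(M, τ)` is `M`. -/
lemma exists_eq_trace_mul {τ : TracialState S} (hτ : τ.IsNormal) {C : ℝ} (hC : 0 ≤ C)
    (φ : StrongDual ℂ S) (hφ : ∀ z : S, ‖φ z‖ ≤ C * ‖embed τ z‖) :
    ∃ h : S, ‖h‖ ≤ C ∧ ∀ z : S, φ z = τ.toFunctional (h * z) := by
  let B : StrongDual ℂ S →ₗ[ℂ] S →ₗ[ℂ] ℂ := ContinuousLinearMap.coeLM ℂ
  let e : S → WeakBilin B := fun h => embed τ h
  have hB : Function.Injective B := ContinuousLinearMap.coe_injective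
  -- For the topology of pointwise convergence on `S`, the functionals `τ (h ·)` with `‖h‖ ≤ C` form
  -- a compact convex set. If `φ` were outside, Hahn–Banach would separate it by evaluation at some
  -- `x`; but the supremum of `re τ (h x)` over this ball is `C * ‖embed τ x‖`, against `hφ`.
  have hcomp : IsCompact (e '' Metric.closedBall 0 C) := by
    rw [isCompact_iff_ultrafilter_le_nhds']
    intro V hV
    set U : Ultrafilter S := Ultrafilter.ofComapInfPrincipal hV
    have hU : Metric.closedBall 0 C ∈ U := Ultrafilter.ofComapInfPrincipal_mem hV
    rw [← Ultrafilter.ofComapInfPrincipal_eq_of_map hV]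
    have hU' : ∀ᶠ h in (U : Filter S), ‖h‖ ≤ C := by
      filter_upwards [hU] with h hh using by simpa using hh
    obtain ⟨h₀, hh₀, hlim⟩ := exists_weak_limit_mem U hU'
    refine ⟨e h₀, ⟨h₀, by simpa using hh₀, rfl⟩, ?_⟩
    exact (WeakBilin.tendsto_iff_forall_eval_tendsto B hB).mpr (hτ.tendsto U hU' hlim)
  have hconv : Convex ℝ (e '' Metric.closedBall 0 C) := by
    have := (convex_closedBall (0 : S) C).linear_image ((embed τ).restrictScalars ℝ)
    exact this
  have hT2 : T2Space (WeakBilin B) := (WeakBilin.isEmbedding hB).t2Space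
  by_contra hcon
  have hmem : (φ : WeakBilin B) ∉ e '' Metric.closedBall 0 C := by
    rintro ⟨h, hh, rfl⟩
    exact hcon ⟨h, by simpa using hh, fun z => rfl⟩
  obtain ⟨f, r, hf1, hf2⟩ := RCLike.geometric_hahn_banach_closed_point (𝕜 := ℂ) hconv
    hcomp.isClosed hmem
  obtain ⟨x, rfl⟩ := LinearMap.dualEmbedding_surjective B f
  have h1 : ∀ h : S, ‖h‖ ≤ C → (τ.toFunctional (h * x)).re < r := fun h hh =>
    hf1 (e h) ⟨h, by simpa using hh, rfl⟩
  have h2 : r < (φ x).re := hf2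
  have h3 : (φ x).re ≤ C * ‖embed τ x‖ := (Complex.re_le_norm _).trans (hφ x)
  have hr : 0 < r := by simpa using h1 0 (by simpa using hC)
  have h4 : ‖embed τ x‖ * C ≤ r := by
    rcases hC.eq_or_lt with rfl | hC
    · simpa using hr.le
    rw [← le_div_iff₀ hC]
    refine ContinuousLinearMap.opNorm_le_of_unit_norm (by positivity) fun z hz => ?_
    -- The phase `c` makes the value real, so a bound on real parts bounds the norm.
    obtain ⟨c, hc, hcz⟩ := RCLike.exists_norm_eq_mul_self (embed τ x z)
    have h5 := h1 ((C * c : ℂ) • z) (by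
      rw [norm_smul, norm_mul, hc, hz, Complex.norm_real, Real.norm_of_nonneg hC.le]
      simp)
    rw [smul_mul_assoc, map_smul, τ.comm' z x, ← embed_apply, smul_eq_mul, mul_assoc, ← hcz,
      Complex.re_ofReal_mul] at h5
    have h6 : C * ‖embed τ x z‖ < r := h5
    rw [le_div_iff₀ hC]
    linarith
  linarith

end Compactness

/-! ### Radon–Nikodym operators and the commutant of right multiplications. -/

section Commutant

/-- The bound makes the form depend only on `e x` and `e z`; it is extended by density in one
variable after the other, and Riesz representation gives the operator. -/
lemma exists_inner_eq_of_norm_le {V E : Type*} [AddCommGroup V] [Module ℂ V]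
    [NormedAddCommGroup E] [InnerProductSpace ℂ E] [CompleteSpace E] (e : V →ₗ[ℂ] E)
    (hdense : DenseRange e) (b : V →ₗ⋆[ℂ] V →ₗ[ℂ] ℂ) (hb : ∀ x z, ‖b x z‖ ≤ ‖e x‖ * ‖e z‖) :
    ∃ T : E →L[ℂ] E, ‖T‖ ≤ 1 ∧ ∀ x z, ⟪e x, T (e z)⟫_ℂ = b x z := by
  let g : V →ₗ⋆[ℂ] StrongDual ℂ E :=
    { toFun := fun x => (b x).extendOfNorm e
      map_add' := fun x y => by
        refine ContinuousLinearMap.ext_on (R₁ := ℂ) (hdense.mono Submodule.subset_span) ?_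
        rintro _ ⟨z, rfl⟩
        simp only [_root_.add_apply]
        rw [LinearMap.extendOfNorm_eq hdense ⟨_, hb _⟩, LinearMap.extendOfNorm_eq hdense ⟨_, hb _⟩,
          LinearMap.extendOfNorm_eq hdense ⟨_, hb _⟩, map_add, LinearMap.add_apply]
      map_smul' := fun c x => by
        refine ContinuousLinearMap.ext_on (R₁ := ℂ) (hdense.mono Submodule.subset_span) ?_
        rintro _ ⟨z, rfl⟩
        simp only [_root_.smul_apply]
        rw [LinearMap.extendOfNorm_eq hdense ⟨_, hb _⟩, LinearMap.extendOfNorm_eq hdense ⟨_, hb _⟩,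
          map_smulₛₗ, LinearMap.smul_apply] }
  have hg : ∀ x, ‖g x‖ ≤ 1 * ‖e x‖ := fun x => by
    rw [one_mul]
    exact LinearMap.opNorm_extendOfNorm_le hdense (norm_nonneg _) (hb x)
  let f : E →L⋆[ℂ] StrongDual ℂ E := g.extendOfNorm e
  have hf : ∀ x z, f (e x) (e z) = b x z := fun x z => by
    have h1 : f (e x) = g x := LinearMap.extendOfNorm_eq hdense ⟨1, hg⟩ x
    rw [h1]
    exact LinearMap.extendOfNorm_eq hdense ⟨_, hb _⟩ z
  have hfn : ∀ ξ, ‖f ξ‖ ≤ 1 * ‖ξ‖ := LinearMap.norm_extendOfNorm_apply_le hdense 1 hg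
  let T : E →L[ℂ] E := InnerProductSpace.continuousLinearMapOfBilin f
  have hT : ∀ ξ η, ⟪T ξ, η⟫_ℂ = f ξ η := InnerProductSpace.continuousLinearMapOfBilin_apply f
  refine ⟨T.adjoint, ?_, fun x z => ?_⟩
  · rw [LinearIsometryEquiv.norm_map]
    refine T.opNorm_le_bound zero_le_one fun ξ => ?_
    rw [← innerSL_apply_norm (𝕜 := ℂ) (T ξ)]
    have : innerSL ℂ (T ξ) = f ξ := by
      ext η
      exact hT ξ η
    rw [this]
    exact hfn ξ
  · rw [ContinuousLinearMap.adjoint_inner_right, hT, hf]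

variable {M : Type u} [CStarAlgebra M] (τ : TracialState M)

/-- On the orbit `ξ M` the form `(ξ x, ξ z) ↦ u (z x*)` is contractive, hence given by an operator
on the closure `K` of the orbit. It commutes with right multiplications because `x` and `z` enter
only through `z x*`. Extension by `0` on the complement of `K` preserves this. -/
lemma exists_commuting_contraction (u : StrongDual ℂ M) (ξ : L2 τ)
    (hu : ∀ x z, ‖u (z * star x)‖ ≤ ‖rightMul τ x ξ‖ * ‖rightMul τ z ξ‖) :
    ∃ T : L2 τ →L[ℂ] L2 τ, ‖T‖ ≤ 1 ∧
      (∀ y η, T (rightMul τ y η) = rightMul τ y (T η)) ∧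
      ∀ x, u x = ⟪ξ, T (rightMul τ x ξ)⟫_ℂ := by
  let e₀ : M →ₗ[ℂ] L2 τ := ((rightMulCLM τ).flip ξ).toLinearMap
  have he₀ : ∀ x, e₀ x = rightMul τ x ξ := fun x => rfl
  let K : Submodule ℂ (L2 τ) := (LinearMap.range e₀).topologicalClosure
  have hmemK : ∀ x, e₀ x ∈ K := fun x =>
    Submodule.le_topologicalClosure _ (LinearMap.mem_range_self _ _)
  have hcomplete : CompleteSpace K :=
    (Submodule.isClosed_topologicalClosure _).completeSpace_coe
  let e : M →ₗ[ℂ] K := e₀.codRestrict K hmemK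
  have hcoe : ∀ x, (e x : L2 τ) = rightMul τ x ξ := fun x => rfl
  have hdense : DenseRange e := by
    intro k
    rw [closure_subtype]
    have : ((↑) : K → L2 τ) '' Set.range e = Set.range e₀ := by
      rw [← Set.range_comp]
      rfl
    rw [this]
    exact k.2
  let b : M →ₗ⋆[ℂ] M →ₗ[ℂ] ℂ :=
    LinearMap.mk₂'ₛₗ (starRingEnd ℂ) (RingHom.id ℂ) (fun x z => u (z * star x))
      (fun x y z => by simp [mul_add]) (fun c x z => by simp)
      (fun x y z => by simp [add_mul]) (fun c x z => by simp)
  obtain ⟨T₀, hT₀, hb⟩ := exists_inner_eq_of_norm_le e hdense b hu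
  have hinner : ∀ x z, ⟪rightMul τ x ξ, (T₀ (e z) : L2 τ)⟫_ℂ = u (z * star x) := hb
  have hK : ∀ y, ∀ k ∈ K, rightMul τ y k ∈ K := fun y k hk => by
    have hmaps : Set.MapsTo (rightMul τ y) (LinearMap.range e₀ : Set (L2 τ))
        (LinearMap.range e₀ : Set (L2 τ)) := by
      rintro _ ⟨x, rfl⟩
      exact ⟨x * y, by rw [he₀, he₀, rightMul_mul]⟩
    exact hmaps.closure (rightMul τ y).continuous hk
  -- `K` is invariant under every right multiplication, hence under their adjoints, so its
  -- complement is invariant too.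
  have hproj : ∀ y η, (K.orthogonalProjectionOnto (rightMul τ y η) : L2 τ) =
      rightMul τ y (K.orthogonalProjectionOnto η) := fun y η => by
    refine Submodule.eq_starProjection_of_mem_of_inner_eq_zero (hK y _ (SetLike.coe_mem _))
      fun w hw => ?_
    rw [← map_sub, inner_rightMul_left]
    exact Submodule.starProjection_inner_eq_zero _ _ (hK _ w hw)
  have hcomm : ∀ y (k k' : K), (k' : L2 τ) = rightMul τ y k →
      (T₀ k' : L2 τ) = rightMul τ y (T₀ k) := fun y => by
    have hmem : ∀ k : K, rightMul τ y k ∈ K := fun k => hK y k k.2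
    suffices h : ∀ k : K, (T₀ ⟨_, hmem k⟩ : L2 τ) = rightMul τ y (T₀ k) by
      intro k k' hk'
      rw [← h k]
      congr 2
      exact Subtype.ext hk'
    intro k
    induction k using hdense.induction_on with
    | hp =>
      refine isClosed_eq ?_ (by fun_prop)
      exact continuous_subtype_val.comp (T₀.continuous.comp
        (((rightMul τ y).continuous.comp continuous_subtype_val).subtype_mk _))
    | ih z =>
      have h1 : (⟨_, hmem (e z)⟩ : K) = e (z * y) := by
        exact Subtype.ext (rightMul_mul τ z y ξ).symm
      rw [h1]
      -- Against `k = e x`, both sides are `u (z * y * star x)`.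
      have h2 : ∀ k : K, ⟪(k : L2 τ), (T₀ (e (z * y)) : L2 τ)⟫_ℂ =
          ⟪(k : L2 τ), rightMul τ y (T₀ (e z))⟫_ℂ := fun k => by
        induction k using hdense.induction_on with
        | hp => exact isClosed_eq (by fun_prop) (by fun_prop)
        | ih x =>
          rw [hcoe, hinner, inner_rightMul_right, ← rightMul_mul, hinner, star_mul, star_star,
            mul_assoc]
      have h3 : (⟨_, hmem (T₀ (e z))⟩ : K) = T₀ (e (z * y)) :=
        ext_inner_left ℂ fun k => (h2 k).symm
      exact (congrArg Subtype.val h3).symm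
  refine ⟨K.subtypeL ∘L T₀ ∘L K.orthogonalProjectionOnto, ?_, fun y η => ?_, fun x => ?_⟩
  · refine ContinuousLinearMap.opNorm_le_bound _ zero_le_one fun η => ?_
    calc ‖(T₀ (K.orthogonalProjectionOnto η) : L2 τ)‖ = ‖T₀ (K.orthogonalProjectionOnto η)‖ := rfl
      _ ≤ 1 * ‖K.orthogonalProjectionOnto η‖ := T₀.le_of_opNorm_le hT₀ _
      _ ≤ 1 * ‖η‖ := by
        gcongr
        exact Submodule.norm_orthogonalProjectionOnto_apply_le _ _
  · exact hcomm y _ _ (hproj y η)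
  · have h1 : K.orthogonalProjectionOnto (rightMul τ x ξ) = e x :=
      Submodule.orthogonalProjectionOnto_mem_subspace_eq_self (e x)
    have h2 := hinner 1 x
    rw [star_one, mul_one, rightMul_one] at h2
    rw [← h2, ← h1]
    rfl

variable {H : Type u} [NormedAddCommGroup H] [InnerProductSpace ℂ H] [CompleteSpace H]
  {S : VonNeumannAlgebra H}

/-- The commutant of the right multiplications is the algebra of left multiplications. -/
lemma exists_leftMul_eq {τ : TracialState S} (hτ : τ.IsNormal) (T : L2 τ →L[ℂ] L2 τ)
    (hT : ∀ y η, T (rightMul τ y η) = rightMul τ y (T η)) :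
    ∃ h : S, ‖h‖ ≤ ‖T‖ ∧ leftMul τ h = T := by
  have hmul : ∀ x y : S, ⟪toL2 τ 1, T (toL2 τ (x * y))⟫_ℂ =
      ⟪toL2 τ (star y), T (toL2 τ x)⟫_ℂ := fun x y => by
    rw [← rightMul_toL2, hT, inner_rightMul_right, rightMul_toL2, one_mul]
  let φ : StrongDual ℂ S := LinearMap.mkContinuous
    ((innerSL ℂ (toL2 τ 1) ∘L T).toLinearMap ∘ₗ toL2 τ) ‖T‖ fun x => by
      calc ‖⟪toL2 τ 1, T (toL2 τ x)⟫_ℂ‖ ≤ ‖toL2 τ (1 : S)‖ * ‖T (toL2 τ x)‖ :=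
            norm_inner_le_norm _ _
        _ ≤ 1 * (‖T‖ * ‖x‖) := by
            rw [norm_toL2_one]
            gcongr
            exact T.le_opNorm_of_le (norm_toL2_le τ x)
        _ = ‖T‖ * ‖x‖ := one_mul _
  have hφ : ∀ x, φ x = ⟪toL2 τ 1, T (toL2 τ x)⟫_ℂ := fun x => rfl
  -- The `L₁`-bound on `φ` comes from `z = x * y` with both factors of `L₂`-norm about `‖z‖₁^(1/2)`:
  -- commutation moves `y` to the other side of the inner product.
  obtain ⟨h, hh, hhφ⟩ := exists_eq_trace_mul hτ (norm_nonneg T) φ fun z => by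
    have key : ∀ ε > 0, ‖φ z‖ ≤ ‖T‖ * (‖embed τ z‖ + ε) := fun ε hε => by
      obtain ⟨x, y, rfl, hx, hy⟩ := exists_eq_mul_norm_sq_le τ z hε
      rw [hφ, hmul]
      calc ‖⟪toL2 τ (star y), T (toL2 τ x)⟫_ℂ‖
          ≤ ‖toL2 τ (star y)‖ * ‖T (toL2 τ x)‖ := norm_inner_le_norm _ _
        _ ≤ ‖toL2 τ y‖ * (‖T‖ * ‖toL2 τ x‖) := by
          rw [norm_toL2_star]
          gcongr
          exact T.le_opNorm _
        _ = ‖T‖ * (‖toL2 τ x‖ * ‖toL2 τ y‖) := by ring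
        _ ≤ ‖T‖ * (‖embed τ (x * y)‖ + ε) := by
          gcongr
          nlinarith [sq_nonneg (‖toL2 τ x‖ - ‖toL2 τ y‖)]
    have hlim : Filter.Tendsto (fun ε : ℝ => ‖T‖ * (‖embed τ z‖ + ε)) (nhdsWithin 0 (Set.Ioi 0))
        (nhds (‖T‖ * (‖embed τ z‖ + 0))) :=
      (Continuous.tendsto (by fun_prop) 0).mono_left nhdsWithin_le_nhds
    rw [add_zero] at hlim
    exact ge_of_tendsto hlim (Filter.eventually_of_mem self_mem_nhdsWithin key)
  refine ⟨h, hh, ?_⟩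
  ext ξ
  induction ξ using L2.induction_on with
  | hp => exact isClosed_eq (ContinuousLinearMap.continuous _) (ContinuousLinearMap.continuous _)
  | h y =>
    refine ext_inner_left ℂ fun η => ?_
    induction η using L2.induction_on with
    | hp => exact isClosed_eq (by fun_prop) (by fun_prop)
    | h x =>
      have h1 := hmul y (star x)
      rw [star_star] at h1
      rw [← h1, ← hφ, hhφ, leftMul_toL2, inner_toL2, τ.comm' (star x), mul_assoc]

end Commutant

/-! ### Domination of functionals and majorants in `L₁`. -/

section Positivity

variable {M : Type u} [CStarAlgebra M]

lemma IsPos.map_star {p : StrongDual ℂ M} (hp : IsPos p) (x : M) : p (star x) = star (p x) := by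
  let _ := CStarAlgebra.spectralOrder M
  let _ := CStarAlgebra.spectralOrderedRing M
  let g : M →ₚ[ℂ] ℂ := PositiveLinearMap.mk₀ (p : M →ₗ[ℂ] ℂ) (by
    intro a ha
    obtain ⟨b, rfl⟩ := CStarAlgebra.nonneg_iff_eq_star_mul_self.mp ha
    exact hp b)
  exact StarHomClass.map_star g x

lemma IsPos.re_nonneg {p : StrongDual ℂ M} (hp : IsPos p) (x : M) : 0 ≤ (p (star x * x)).re :=
  (Complex.le_def.mp (hp x)).1

/-- The Cauchy–Schwarz inequality for positive functionals. -/
lemma IsPos.norm_le {p : StrongDual ℂ M} (hp : IsPos p) (x y : M) :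
    ‖p (star x * y)‖ ≤ √(p (star x * x)).re * √(p (star y * y)).re := by
  let c : PreInnerProductSpace.Core ℂ M :=
    { inner := fun a b => p (star a * b)
      conj_inner_symm := fun a b => by
        rw [← Complex.star_def, ← hp.map_star]
        simp
      re_inner_nonneg := fun a => hp.re_nonneg a
      add_left := fun a b c => by simp [add_mul]
      smul_left := fun a b r => by simp }
  have h1 : ‖p (star x * y)‖ * ‖p (star y * x)‖ ≤ (p (star x * x)).re * (p (star y * y)).re :=
    InnerProductSpace.Core.inner_mul_inner_self_le (c := c) x y
  have h2 : ‖p (star y * x)‖ = ‖p (star x * y)‖ := by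
    rw [← norm_star (p (star x * y)), ← hp.map_star, star_mul, star_star]
  rw [h2, ← sq] at h1
  rw [← Real.sqrt_mul (hp.re_nonneg x)]
  exact Real.le_sqrt_of_sq_le h1

/-- The sesquilinear form of `u` is dominated by the quadratic form of `g`. -/
def IsDominated (u g : StrongDual ℂ M) : Prop :=
  ∀ x y : M, ‖u (star x * y)‖ ≤ √(g (star x * x)).re * √(g (star y * y)).re

lemma sqrt_mul_sqrt_add_le {a b c d : ℝ} (ha : 0 ≤ a) (hb : 0 ≤ b) (hc : 0 ≤ c) (hd : 0 ≤ d) :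
    √a * √b + √c * √d ≤ √(a + c) * √(b + d) := by
  rw [← Real.sqrt_mul (add_nonneg ha hc)]
  refine Real.le_sqrt_of_sq_le ?_
  have h1 := Real.sq_sqrt ha
  have h2 := Real.sq_sqrt hb
  have h3 := Real.sq_sqrt hc
  have h4 := Real.sq_sqrt hd
  calc (√a * √b + √c * √d) ^ 2
      ≤ (√a ^ 2 + √c ^ 2) * (√b ^ 2 + √d ^ 2) := by
        nlinarith [sq_nonneg (√a * √d - √c * √b)]
    _ = (a + c) * (b + d) := by rw [h1, h2, h3, h4]

/-- Together with `IsDominated.smul`, this lets the real and imaginary parts of `f` be treated by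
the sum of their majorants, where an order bound `-g ≤ u ≤ g` would make no sense. -/
lemma IsDominated.add {u₁ u₂ g₁ g₂ : StrongDual ℂ M} (h₁ : IsDominated u₁ g₁)
    (h₂ : IsDominated u₂ g₂) (hg₁ : IsPos g₁) (hg₂ : IsPos g₂) :
    IsDominated (u₁ + u₂) (g₁ + g₂) := fun x y =>
  calc ‖(u₁ + u₂) (star x * y)‖ ≤ ‖u₁ (star x * y)‖ + ‖u₂ (star x * y)‖ := norm_add_le _ _
    _ ≤ _ := add_le_add (h₁ x y) (h₂ x y)
    _ ≤ _ := sqrt_mul_sqrt_add_le (hg₁.re_nonneg x) (hg₁.re_nonneg y) (hg₂.re_nonneg x)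
      (hg₂.re_nonneg y)

lemma IsDominated.smul {u g : StrongDual ℂ M} (h : IsDominated u g) {c : ℂ} (hc : ‖c‖ = 1) :
    IsDominated (c • u) g := fun x y => by
  rw [_root_.smul_apply, norm_smul, hc, one_mul]
  exact h x y

/-- Apply Cauchy–Schwarz to the positive forms `g + u` and `g - u`: half their difference is `u`,
and their quadratic forms add up to twice that of `g`. -/
lemma isDominated_of_isPos {u g : StrongDual ℂ M} (h₁ : IsPos (g - u)) (h₂ : IsPos (g + u)) :
    IsDominated u g := fun x y => by
  have h3 : u (star x * y) = ((g + u) (star x * y) - (g - u) (star x * y)) / 2 := by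
    simp
  have h4 := (norm_sub_le ((g + u) (star x * y)) ((g - u) (star x * y))).trans
    (add_le_add (h₂.norm_le x y) (h₁.norm_le x y))
  have h5 := sqrt_mul_sqrt_add_le (h₂.re_nonneg x) (h₂.re_nonneg y) (h₁.re_nonneg x)
    (h₁.re_nonneg y)
  have h6 : ∀ z, ((g + u) (star z * z)).re + ((g - u) (star z * z)).re =
      2 * (g (star z * z)).re := fun z => by
    simp only [_root_.add_apply, _root_.sub_apply, Complex.add_re, Complex.sub_re]
    ring
  have h7 : √2 * √2 = 2 := Real.mul_self_sqrt zero_le_two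
  rw [h6, h6, Real.sqrt_mul zero_le_two, Real.sqrt_mul zero_le_two, mul_mul_mul_comm, h7] at h5
  rw [h3, norm_div, Complex.norm_ofNat]
  linarith

lemma isPos_of_isPos_sub_add {u g : StrongDual ℂ M} (h₁ : IsPos (g - u)) (h₂ : IsPos (g + u)) :
    IsPos g := fun x => by
  have h := add_nonneg (h₁ x) (h₂ x)
  simp only [_root_.add_apply, _root_.sub_apply, sub_add_add_cancel] at h
  rw [Complex.le_def] at h ⊢
  simp only [Complex.zero_re, Complex.zero_im, Complex.add_re, Complex.add_im] at h ⊢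
  exact ⟨by linarith [h.1], by linarith [h.2]⟩

lemma compress_apply (p : M) (f : StrongDual ℂ M) (x : M) : compress p f x = f (p * x * p) := rfl

lemma compress_star_mul {p : M} (hp : star p = p) (f : StrongDual ℂ M) (x y : M) :
    compress p f (star x * y) = f (star (x * p) * (y * p)) := by
  rw [compress_apply, star_mul, hp]
  simp only [mul_assoc]

lemma IsDominated.compress {u g : StrongDual ℂ M} (h : IsDominated u g) {p : M}
    (hp : star p = p) : IsDominated (compress p u) (compress p g) := fun x y => by
  simp only [compress_star_mul hp]
  exact h _ _

lemma IsDominated.mono {u g g' : StrongDual ℂ M} (h : IsDominated u g)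
    (hg : ∀ x, (g (star x * x)).re ≤ (g' (star x * x)).re) : IsDominated u g' := fun x y =>
  (h x y).trans (mul_le_mul (Real.sqrt_le_sqrt (hg x)) (Real.sqrt_le_sqrt (hg y))
    (Real.sqrt_nonneg _) (Real.sqrt_nonneg _))

variable (τ : TracialState M)

lemma TracialState.re_map_star (x : M) :
    (τ.toFunctional (star x)).re = (τ.toFunctional x).re := by
  have h := congrArg Complex.re (τ.map_star x)
  exact h

lemma norm_embed_star_le (z : M) : ‖embed τ (star z)‖ ≤ ‖embed τ z‖ :=
  ContinuousLinearMap.opNorm_le_bound _ (norm_nonneg _) fun x => by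
    have h : embed τ (star z) x = star (embed τ z (star x)) := by
      have h1 := τ.map_star (z * star x)
      rw [star_mul, star_star] at h1
      exact (τ.comm' _ _).trans h1
    rw [h, norm_star, ← norm_star x]
    exact (embed τ z).le_opNorm _

section Order

variable [PartialOrder M] [StarOrderedRing M]

lemma TracialState.re_mul_nonneg {a : M} (ha : 0 ≤ a) (x : M) :
    0 ≤ (τ.toFunctional (a * (star x * x))).re := by
  rw [← mul_assoc, τ.comm' (a * star x) x, ← mul_assoc]
  exact τ.re_nonneg (star_right_conjugate_nonneg ha x)

lemma norm_toL2_sqrt_sq {c : M} (hc : 0 ≤ c) : ‖toL2 τ (CFC.sqrt c)‖ ^ 2 = (τ.toFunctional c).re := by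
  have h : star (CFC.sqrt c) = CFC.sqrt c := (CFC.sqrt_nonneg c).isSelfAdjoint
  rw [norm_sq_toL2, h, CFC.sqrt_mul_sqrt_self c hc]

/-- A Powers–Størmer inequality. With `s = √c ≤ t = √d` by operator monotonicity, `τ (s (t - s)) ≥
0` gives `τ (s t) ≥ τ c`; then expand the square. -/
lemma norm_toL2_sqrt_sub_sqrt_sq_le {c d : M} (hc : 0 ≤ c) (hcd : c ≤ d) :
    ‖toL2 τ (CFC.sqrt d) - toL2 τ (CFC.sqrt c)‖ ^ 2 ≤
      (τ.toFunctional d).re - (τ.toFunctional c).re := by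
  have hd := hc.trans hcd
  set s := CFC.sqrt c with hs
  set t := CFC.sqrt d with ht
  have hs0 : 0 ≤ s := CFC.sqrt_nonneg c
  have hss : star s = s := hs0.isSelfAdjoint
  have hts : star t = t := (CFC.sqrt_nonneg d).isSelfAdjoint
  have hs2 : s * s = c := CFC.sqrt_mul_sqrt_self c hc
  have ht2 : t * t = d := CFC.sqrt_mul_sqrt_self d hd
  have hst : 0 ≤ t - s := sub_nonneg.mpr (CFC.sqrt_le_sqrt c d hcd)
  obtain ⟨r, hr⟩ := CStarAlgebra.nonneg_iff_eq_star_mul_self.mp hst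
  have h1 := τ.re_mul_nonneg hs0 r
  rw [← hr, mul_sub, hs2, map_sub, Complex.sub_re] at h1
  rw [← map_sub, norm_sq_toL2, star_sub, hss, hts, sub_mul, mul_sub, mul_sub, hs2, ht2,
    map_sub, map_sub, map_sub, τ.comm' t s]
  simp only [Complex.sub_re]
  linarith

end Order

open Filter Topology

/-- This replaces the positive part of `re f`. Write `f` as a rapidly convergent series of elements
of `M` and let `p n` be the positive parts of their real parts. The square roots of the partial sums
of `p n` converge in `L₂` by Powers–Størmer, and the limit `ξ` satisfies `ξ* ξ = ∑ p n ≥ re f`. -/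
lemma exists_vector_majorant (f : L1 τ) {δ : ℝ} (hδ : 0 < δ) :
    ∃ ξ : L2 τ, ‖ξ‖ ^ 2 ≤ ‖f‖ + δ ∧
      ∀ x, (f.toDual (star x * x)).re ≤ ‖rightMul τ (star x) ξ‖ ^ 2 := by
  let _ := CStarAlgebra.spectralOrder M
  let _ := CStarAlgebra.spectralOrderedRing M
  obtain ⟨v, hv, hmem, hv0, hvn⟩ := controlled_sum_of_mem_closure
    (s := (LinearMap.range (embed τ)).toAddSubgroup) (L1.toDual_mem τ f)
    (b := fun n => δ / 2 / 2 ^ n) (fun n => by positivity)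
  choose z hz using hmem
  set w : ℕ → M := fun n => (2⁻¹ : ℂ) • (z n + star (z n)) with hw
  have hwsa : ∀ n, IsSelfAdjoint (w n) := fun n => by
    simp only [hw, IsSelfAdjoint, star_smul, star_add, star_star, add_comm (star (z n))]
    simp
  have hwn : ∀ n, ‖embed τ (w n)‖ ≤ ‖v n‖ := fun n => by
    rw [hw, map_smul, map_add, norm_smul, ← hz n]
    have := (norm_add_le (embed τ (z n)) (embed τ (star (z n)))).trans
      (add_le_add_right (norm_embed_star_le τ (z n)) _)
    rw [norm_inv, Complex.norm_ofNat]
    linarith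
  have hwz : ∀ n x, (τ.toFunctional (w n * (star x * x))).re =
      (v n (star x * x)).re := fun n x => by
    have h1 := τ.re_map_star (z n * (star x * x))
    rw [star_mul, star_mul, star_star, τ.comm' (star x * x)] at h1
    rw [← hz n, embed_apply, hw, smul_mul_assoc, map_smul, add_mul, map_add, smul_eq_mul,
      ← Complex.ofReal_ofNat, ← Complex.ofReal_inv, Complex.re_ofReal_mul, Complex.add_re, h1]
    ring
  set p : ℕ → M := fun n => cfc (fun t : ℝ => max t 0) (w n) with hp
  have hp0 : ∀ n, 0 ≤ p n := fun n => cfc_nonneg fun t _ => le_max_right _ _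
  have hwp : ∀ n, 0 ≤ p n - w n := fun n => by
    rw [sub_nonneg]
    nth_rw 1 [← cfc_id' ℝ (w n) (hwsa n)]
    exact cfc_mono (fun t _ => le_max_left _ _) (by fun_prop) (by fun_prop)
  have hpn : ∀ n, (τ.toFunctional (p n)).re ≤ ‖v n‖ := fun n =>
    (re_trace_posPart_le τ (hwsa n)).trans (hwn n)
  -- The term `v 0` is within `δ / 2` of `f`, and the errors `δ / 2 / 2 ^ n` add up to `δ`.
  set B : ℕ → ℝ := fun n => (if n = 0 then ‖f‖ else 0) + δ / 2 / 2 ^ n with hB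
  have hBsum : HasSum B (‖f‖ + δ) := (hasSum_ite_eq 0 ‖f‖).add (hasSum_geometric_two' δ)
  have hpB : ∀ n, (τ.toFunctional (p n)).re ≤ B n := fun n => by
    refine (hpn n).trans ?_
    rcases Nat.eq_zero_or_pos n with rfl | hn
    · have h1 := norm_le_norm_add_norm_sub' (v 0) f.toDual
      rw [L1.norm_toDual] at h1
      rw [neg_add_eq_sub, norm_sub_rev] at hv0
      simp only [hB, if_pos]
      linarith
    · simp only [hB, if_neg hn.ne', zero_add]
      exact (hvn n hn).le
  have hpsum : Summable fun n => (τ.toFunctional (p n)).re :=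
    hBsum.summable.of_nonneg_of_le (fun n => τ.re_nonneg (hp0 n)) hpB
  set c : ℕ → M := fun n => ∑ i ∈ Finset.range n, p i with hc
  have hc0 : ∀ n, 0 ≤ c n := fun n => Finset.sum_nonneg fun i _ => hp0 i
  have hcmono : Monotone c := monotone_nat_of_le_succ fun n => by
    simp only [hc, Finset.sum_range_succ]
    exact le_add_of_nonneg_right (hp0 n)
  set A : ℝ := ∑' n, (τ.toFunctional (p n)).re with hA
  have hctr : ∀ n, (τ.toFunctional (c n)).re =
      ∑ i ∈ Finset.range n, (τ.toFunctional (p i)).re := fun n => by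
    simp only [hc, map_sum, Complex.re_sum]
  have hclim : Tendsto (fun n => (τ.toFunctional (c n)).re) atTop (𝓝 A) := by
    simp only [hctr]
    exact hpsum.hasSum.tendsto_sum_nat
  have hcA : ∀ n, (τ.toFunctional (c n)).re ≤ A := fun n => by
    rw [hctr]
    exact hpsum.sum_le_tsum _ fun i _ => τ.re_nonneg (hp0 i)
  have hcauchy : CauchySeq fun n => toL2 τ (CFC.sqrt (c n)) := by
    refine cauchySeq_of_le_tendsto_0' (fun n => √(A - (τ.toFunctional (c n)).re))
      (fun n m hnm => ?_) ?_
    · rw [dist_eq_norm, norm_sub_rev]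
      refine Real.le_sqrt_of_sq_le ((norm_toL2_sqrt_sub_sqrt_sq_le τ (hc0 n) (hcmono hnm)).trans ?_)
      linarith [hcA m]
    · have := (tendsto_const_nhds (x := A)).sub hclim
      rw [sub_self] at this
      simpa using this.sqrt
  obtain ⟨ξ, hξ⟩ := cauchySeq_tendsto_of_complete hcauchy
  refine ⟨ξ, ?_, fun x => ?_⟩
  · have h1 : Tendsto (fun n => (τ.toFunctional (c n)).re) atTop (𝓝 (‖ξ‖ ^ 2)) := by
      refine (hξ.norm.pow 2).congr fun n => ?_
      rw [norm_toL2_sqrt_sq τ (hc0 n)]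
    rw [tendsto_nhds_unique h1 hclim]
    exact (hpsum.tsum_le_tsum hpB hBsum.summable).trans_eq hBsum.tsum_eq
  · have h1 : Tendsto (fun n => (τ.toFunctional (c n * (star x * x))).re) atTop
        (𝓝 (‖rightMul τ (star x) ξ‖ ^ 2)) := by
      refine ((((rightMul τ (star x)).continuous.tendsto ξ).comp hξ).norm.pow 2).congr fun n => ?_
      have h : star (CFC.sqrt (c n)) = CFC.sqrt (c n) := (CFC.sqrt_nonneg _).isSelfAdjoint
      rw [Function.comp_apply, rightMul_toL2, norm_sq_toL2, star_mul, star_star, h,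
        τ.comm', ← mul_assoc, mul_assoc (CFC.sqrt (c n)), τ.comm', ← mul_assoc,
        CFC.sqrt_mul_sqrt_self _ (hc0 n)]
    have h2 : Tendsto (fun n => ((∑ i ∈ Finset.range (n + 1), v i) (star x * x)).re) atTop
        (𝓝 (f.toDual (star x * x)).re) :=
      (Complex.continuous_re.tendsto _).comp
        (((ContinuousLinearMap.apply ℂ ℂ (star x * x)).continuous.tendsto _).comp hv)
    refine le_of_tendsto_of_tendsto' h2 (h1.comp (tendsto_add_atTop_nat 1)) fun n => ?_
    simp only [Function.comp_apply, hc, Finset.sum_mul, map_sum, Complex.re_sum,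
      _root_.sum_apply]
    refine Finset.sum_le_sum fun i _ => ?_
    have h3 := τ.re_mul_nonneg (hwp i) x
    rw [sub_mul, map_sub, Complex.sub_re, hwz] at h3
    linarith

/-- A vector majorant `P` writes `f` as a difference `P - (P - f)` of positive elements. -/
lemma IsPositivityPreserving.isSA {τ : TracialState M} {T : L1 τ →ₗ[ℂ] L1 τ}
    (hT : IsPositivityPreserving τ T) {f : L1 τ} (hf : f.IsSA) : (T f).IsSA := by
  obtain ⟨ξ, -, hξ⟩ := exists_vector_majorant τ f one_pos
  obtain ⟨P, hP⟩ := L1.exists_toDual_eq τ (vectorFunctional_mem τ ξ)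
  have hPpos : IsPos P.toDual := fun x => by
    rw [hP, vectorFunctional_star_mul_self, Complex.zero_le_real]
    positivity
  have hNpos : IsPos (P - f).toDual := fun x => by
    rw [L1.toDual_sub, _root_.sub_apply, hP, vectorFunctional_star_mul_self, sub_nonneg,
      Complex.le_def]
    refine ⟨hξ x, ?_⟩
    have h := hf (star x * x)
    rw [star_mul, star_star] at h
    exact Complex.conj_eq_iff_im.mp h.symm
  have hTf : T f = T P - T (P - f) := by rw [map_sub, sub_sub_cancel]
  intro x
  rw [hTf, L1.toDual_sub, _root_.sub_apply, _root_.sub_apply, (hT _ hPpos).map_star,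
    (hT _ hNpos).map_star, star_sub]

lemma norm_leftMul_apply_le (x : M) (ξ : L2 τ) : ‖leftMul τ x ξ‖ ≤ ‖x‖ * ‖ξ‖ := by
  induction ξ using L2.induction_on with
  | hp => exact isClosed_le (by fun_prop) (by fun_prop)
  | h y =>
    rw [leftMul_toL2]
    exact norm_toL2_mul_le τ x y

lemma exists_majorant_of_maxNorm_lt {ι : Type*} {v : ι → L1 τ} (hv : ∀ i, (v i).IsSA)
    {C : ℝ≥0∞} (hC : maxNorm τ (fun i => (v i).toDual) < C) :
    ∃ g : L1 τ, ‖g‖ₑ ≤ C ∧ ∀ i, IsPos (g - v i).toDual ∧ IsPos (g + v i).toDual := by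
  simp only [maxNorm, iInf_lt_iff] at hC
  obtain ⟨a, b, h, ⟨R, hR⟩, hfac, hlt⟩ := hC
  have hsup : (⨆ i, ‖h i‖ₑ) ≠ ∞ := by
    refine ne_top_of_le_ne_top (ENNReal.ofReal_ne_top (r := R)) (iSup_le fun i => ?_)
    rw [← ofReal_norm]
    exact ENNReal.ofReal_le_ofReal (hR ⟨i, rfl⟩)
  set s : ℝ := (⨆ i, ‖h i‖ₑ).toReal with hs
  have hs0 : 0 ≤ s := ENNReal.toReal_nonneg
  have hhs : ∀ i, ‖h i‖ ≤ s := fun i => by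
    rw [← toReal_enorm]
    exact ENNReal.toReal_mono hsup (le_iSup (fun i => ‖h i‖ₑ) i)
  suffices H : ∃ g : L1 τ, ‖g‖ ≤ ‖a‖ * s * ‖b‖ ∧
      ∀ i x, ‖(v i).toDual (star x * x)‖ ≤ (g.toDual (star x * x)).re ∧
        (g.toDual (star x * x)).im = 0 by
    obtain ⟨g, hg, hgv⟩ := H
    refine ⟨g, ?_, fun i => ?_⟩
    · refine le_trans ?_ hlt.le
      rw [← ofReal_norm, ← ofReal_norm a, ← ofReal_norm b,
        ← ENNReal.ofReal_toReal hsup, ← ENNReal.ofReal_mul (norm_nonneg _),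
        ← ENNReal.ofReal_mul (by positivity)]
      exact ENNReal.ofReal_le_ofReal hg
    · have him : ∀ x, ((v i).toDual (star x * x)).im = 0 := fun x => by
        have h := hv i (star x * x)
        rw [star_mul, star_star] at h
        exact Complex.conj_eq_iff_im.mp h.symm
      have habs := fun x => abs_le.mp ((Complex.abs_re_le_norm _).trans (hgv i x).1)
      refine ⟨fun x => ?_, fun x => ?_⟩
      · rw [L1.toDual_sub, _root_.sub_apply, sub_nonneg, Complex.le_def, him, (hgv i x).2]
        exact ⟨(habs x).2, rfl⟩
      · rw [L1.toDual_add, _root_.add_apply, Complex.le_def, Complex.add_re, Complex.add_im, him,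
          (hgv i x).2]
        exact ⟨by simpa using by linarith [(habs x).1], by simp⟩
  have hbound : ∀ i x, ‖(v i).toDual (star x * x)‖ ≤
      s * (‖rightMul τ (star x) a‖ * ‖rightMul τ (star x) b‖) := fun i x => by
    rw [hfac, rightMul_mul, leftMul_rightMul, inner_rightMul_right]
    calc _ ≤ ‖rightMul τ (star x) a‖ * ‖leftMul τ (h i) (rightMul τ (star x) b)‖ :=
          norm_inner_le_norm _ _
      _ ≤ ‖rightMul τ (star x) a‖ * (s * ‖rightMul τ (star x) b‖) := by
          gcongr
          exact (norm_leftMul_apply_le τ _ _).trans (by gcongr; exact hhs i)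
      _ = _ := by ring
  -- If a factor vanishes, the balancing ratio below is unavailable, but then every `v i` vanishes
  -- on positive elements and `0` is a majorant.
  by_cases hab : ‖a‖ = 0 ∨ ‖b‖ = 0
  · refine ⟨0, by rw [norm_zero]; positivity, fun i x => ?_⟩
    have h0 : (0 : L1 τ).toDual = 0 := map_zero (L1.functional τ)
    have h1 := hbound i x
    have h2 : ‖rightMul τ (star x) a‖ * ‖rightMul τ (star x) b‖ = 0 := by
      rcases hab with hab | hab
      · rw [norm_eq_zero.mp hab, map_zero, norm_zero, zero_mul]
      · rw [norm_eq_zero.mp hab, map_zero, norm_zero, mul_zero]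
    rw [h2, mul_zero] at h1
    rw [h0]
    exact ⟨by simpa using h1, rfl⟩
  · push Not at hab
    have ha : 0 < ‖a‖ := (norm_nonneg a).lt_of_ne' hab.1
    have hb : 0 < ‖b‖ := (norm_nonneg b).lt_of_ne' hab.2
    obtain ⟨P, hP⟩ := L1.exists_toDual_eq τ (vectorFunctional_mem τ a)
    obtain ⟨Q, hQ⟩ := L1.exists_toDual_eq τ (vectorFunctional_mem τ b)
    have hPn : ‖P‖ ≤ ‖a‖ ^ 2 := by
      rw [← L1.norm_toDual, hP]
      exact norm_vectorFunctional_le τ a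
    have hQn : ‖Q‖ ≤ ‖b‖ ^ 2 := by
      rw [← L1.norm_toDual, hQ]
      exact norm_vectorFunctional_le τ b
    -- This weight in `2 α β ≤ t α² + t⁻¹ β²` gives both summands of the majorant the same norm
    -- bound, `‖a‖ * s * ‖b‖ / 2`.
    set t : ℝ := ‖b‖ / ‖a‖ with ht
    have ht0 : 0 < t := by positivity
    have hval : ∀ x, (((s / 2 * t : ℝ) : ℂ) • P + ((s / 2 * t⁻¹ : ℝ) : ℂ) • Q).toDual
        (star x * x) = ((s / 2 * t * ‖rightMul τ (star x) a‖ ^ 2 +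
          s / 2 * t⁻¹ * ‖rightMul τ (star x) b‖ ^ 2 : ℝ) : ℂ) := fun x => by
      rw [L1.toDual_add, L1.toDual_smul, L1.toDual_smul, hP, hQ, _root_.add_apply,
        _root_.smul_apply, _root_.smul_apply, vectorFunctional_star_mul_self,
        vectorFunctional_star_mul_self]
      push_cast
      rfl
    refine ⟨((s / 2 * t : ℝ) : ℂ) • P + ((s / 2 * t⁻¹ : ℝ) : ℂ) • Q, ?_, fun i x => ?_⟩
    · calc _ ≤ ‖((s / 2 * t : ℝ) : ℂ) • P‖ + ‖((s / 2 * t⁻¹ : ℝ) : ℂ) • Q‖ := norm_add_le _ _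
        _ = s / 2 * t * ‖P‖ + s / 2 * t⁻¹ * ‖Q‖ := by
          rw [norm_smul, norm_smul, Complex.norm_real, Complex.norm_real,
            Real.norm_of_nonneg (by positivity), Real.norm_of_nonneg (by positivity)]
        _ ≤ s / 2 * t * ‖a‖ ^ 2 + s / 2 * t⁻¹ * ‖b‖ ^ 2 := by gcongr
        _ = ‖a‖ * s * ‖b‖ := by
          rw [ht]
          field_simp
          ring
    · rw [hval, Complex.ofReal_re, Complex.ofReal_im]
      refine ⟨(hbound i x).trans ?_, rfl⟩
      set α := ‖rightMul τ (star x) a‖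
      set β := ‖rightMul τ (star x) b‖
      have h1 : 2 * (α * β) ≤ t * α ^ 2 + t⁻¹ * β ^ 2 := by
        have h2 : t * α ^ 2 + t⁻¹ * β ^ 2 - 2 * (α * β) = t⁻¹ * (t * α - β) ^ 2 := by
          field_simp
          ring
        have h3 : 0 ≤ t⁻¹ * (t * α - β) ^ 2 := by positivity
        linarith
      have h2 := mul_le_mul_of_nonneg_left h1 hs0
      linarith

end Positivity

/-! ### From domination and b.a.u. convergence to the limsup norm. -/

section Limsup

variable {M : Type u} [CStarAlgebra M] (τ : TracialState M)

lemma compress_embed (p z : M) : compress p (embed τ z) = embed τ (p * z * p) := by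
  ext x
  rw [compress_apply, embed_apply, embed_apply, ← mul_assoc, τ.comm' _ p]
  simp only [mul_assoc]

lemma continuous_compress (p : M) : Continuous (compress p) :=
  continuous_id.clm_comp_const _

lemma compress_mem (p : M) {f : StrongDual ℂ M}
    (hf : f ∈ (LinearMap.range (embed τ)).topologicalClosure) :
    compress p f ∈ (LinearMap.range (embed τ)).topologicalClosure := by
  refine map_mem_closure (continuous_compress p) hf ?_
  rintro _ ⟨z, rfl⟩
  exact ⟨p * z * p, (compress_embed τ p z).symm⟩

lemma norm_compress_le {p : M} (hp : ‖p‖ ≤ 1) (f : StrongDual ℂ M) : ‖compress p f‖ ≤ ‖f‖ :=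
  ContinuousLinearMap.opNorm_le_bound _ (norm_nonneg f) fun x => by
    rw [compress_apply]
    refine f.le_opNorm_of_le ?_
    calc ‖p * x * p‖ ≤ ‖p‖ * ‖x‖ * ‖p‖ := norm_mul₃_le
      _ ≤ 1 * ‖x‖ * 1 := by gcongr
      _ = ‖x‖ := by ring

lemma norm_embed_one_le : ‖embed τ (1 : M)‖ ≤ 1 :=
  ContinuousLinearMap.opNorm_le_bound _ zero_le_one fun x => by
    rw [embed_apply, one_mul, one_mul]
    have h := inner_toL2 τ 1 x
    rw [star_one, one_mul] at h
    rw [← h]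
    refine (norm_inner_le_norm _ _).trans ?_
    rw [norm_toL2_one, one_mul]
    exact norm_toL2_le τ x

lemma norm_trace_mul_le (z x : M) :
    ‖τ.toFunctional (z * (star x * x))‖ ≤ ‖z‖ * (τ.toFunctional (star x * x)).re := by
  have h := inner_toL2 τ (star x) (z * star x)
  rw [star_star, τ.comm' x, mul_assoc] at h
  rw [← h, ← norm_sq_toL2, ← norm_toL2_star]
  refine (norm_inner_le_norm _ _).trans ?_
  rw [sq, mul_left_comm]
  gcongr
  exact norm_toL2_mul_le τ z (star x)

lemma maxNorm_le_of_forall_eq {ι : Type*} {u : ι → StrongDual ℂ M} (ξ : L2 τ) (h : ι → M)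
    (hh : ∀ i, ‖h i‖ ≤ 1) (hu : ∀ i x, u i x = ⟪ξ, leftMul τ (h i) (rightMul τ x ξ)⟫_ℂ) :
    maxNorm τ u ≤ ENNReal.ofReal (‖ξ‖ ^ 2) := by
  have hbdd : BddAbove (Set.range fun i => ‖h i‖) := ⟨1, by rintro _ ⟨i, rfl⟩; exact hh i⟩
  have h1 : ⨆ i, ‖h i‖ₑ ≤ 1 := iSup_le fun i => by
    rw [← ofReal_norm, ← ENNReal.ofReal_one]
    exact ENNReal.ofReal_le_ofReal (hh i)
  calc maxNorm τ u ≤ ‖ξ‖ₑ * (⨆ i, ‖h i‖ₑ) * ‖ξ‖ₑ :=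
        iInf₂_le_of_le ξ ξ (iInf_le_of_le h (iInf₂_le hbdd hu))
    _ ≤ ‖ξ‖ₑ * 1 * ‖ξ‖ₑ := by gcongr
    _ = ENNReal.ofReal (‖ξ‖ ^ 2) := by
      rw [mul_one, ← sq, ENNReal.ofReal_pow (norm_nonneg ξ), ofReal_norm]

lemma exists_vector_eventually_majorant {p : M} (hp : IsStarProjection p) {G : ℕ → L1 τ}
    {G₀ : L1 τ} (hlim : Filter.Tendsto
      (fun n => normInfty τ (compress p ((G n).toDual - G₀.toDual))) Filter.atTop (nhds 0))
    {δ : ℝ} (hδ : 0 < δ) :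
    ∃ ξ : L2 τ, ‖ξ‖ ^ 2 ≤ ‖G₀‖ + δ ∧ ∃ N, ∀ n ≥ N, ∀ x,
      (compress p (G n).toDual (star x * x)).re ≤
        (vectorFunctional τ ξ (star x * x)).re := by
  have hη : 0 < δ / 2 := half_pos hδ
  set η : ℝ := δ / 2 with hη_def
  obtain ⟨N, hN⟩ := Filter.eventually_atTop.mp
    (hlim.eventually_lt_const (ENNReal.ofReal_pos.mpr hη))
  -- `Q = p G₀ p + η 1` lies above the real part of `p (G n) p` once the difference of compressions
  -- has operator norm below `η`. Adding `η 1` costs `η = δ / 2` in norm, and passing to a vector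
  -- functional costs another `η`.
  obtain ⟨Q, hQ⟩ := L1.exists_toDual_eq τ (Submodule.add_mem _
    (compress_mem τ p (L1.toDual_mem τ G₀))
    (Submodule.smul_mem _ (η : ℂ)
      (Submodule.le_topologicalClosure _ (LinearMap.mem_range_self (embed τ) 1))))
  have hQn : ‖Q‖ ≤ ‖G₀‖ + η := by
    rw [← L1.norm_toDual, hQ]
    refine (norm_add_le _ _).trans (add_le_add ?_ ?_)
    · exact (norm_compress_le hp.norm_le _).trans_eq (L1.norm_toDual τ G₀)
    · rw [norm_smul, Complex.norm_real, Real.norm_of_nonneg hη.le]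
      exact mul_le_of_le_one_right hη.le (norm_embed_one_le τ)
  obtain ⟨ξ, hξ, hξQ⟩ := exists_vector_majorant τ Q hη
  refine ⟨ξ, by linarith, N, fun n hn x => ?_⟩
  have hlt := hN n hn
  simp only [normInfty, iInf_lt_iff] at hlt
  obtain ⟨z, hz, hzη⟩ := hlt
  have hzη' : ‖z‖ ≤ η := by
    rw [← ofReal_norm, ENNReal.ofReal_lt_ofReal_iff hη] at hzη
    exact hzη.le
  rw [vectorFunctional_star_mul_self, Complex.ofReal_re]
  refine le_trans ?_ (hξQ x)
  have h1 : compress p (G n).toDual (star x * x) - compress p G₀.toDual (star x * x) =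
      τ.toFunctional (z * (star x * x)) := DFunLike.congr_fun hz (star x * x)
  have h2 := (Complex.re_le_norm _).trans (norm_trace_mul_le τ z x)
  rw [← h1, Complex.sub_re] at h2
  have h3 : 0 ≤ (τ.toFunctional (star x * x)).re := by
    rw [← norm_sq_toL2]
    positivity
  have h4 := mul_le_mul_of_nonneg_right hzη' h3
  rw [hQ, _root_.add_apply, _root_.smul_apply, smul_eq_mul, Complex.add_re,
    Complex.re_ofReal_mul, embed_apply, one_mul]
  linarith

variable {H : Type u} [NormedAddCommGroup H] [InnerProductSpace ℂ H] [CompleteSpace H]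
  {S : VonNeumannAlgebra H} {τ : TracialState S}

/-- A Radon–Nikodym theorem: `u = ξ* h ξ` with `h` a contraction in `S`. It converts domination into
the factorization that `maxNorm` asks for, with the same `ξ` for a whole family. -/
lemma exists_eq_inner_leftMul (hτ : τ.IsNormal) {u : StrongDual ℂ S} {ξ : L2 τ}
    (hu : IsDominated u (vectorFunctional τ ξ)) :
    ∃ h : S, ‖h‖ ≤ 1 ∧ ∀ x, u x = ⟪ξ, leftMul τ h (rightMul τ x ξ)⟫_ℂ := by
  obtain ⟨T, hT, hcomm, huT⟩ := exists_commuting_contraction τ u ξ fun x z => by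
    have h := hu (star z) (star x)
    rwa [vectorFunctional_star_mul_self, vectorFunctional_star_mul_self, Complex.ofReal_re,
      Complex.ofReal_re, Real.sqrt_sq (norm_nonneg _), Real.sqrt_sq (norm_nonneg _), star_star,
      star_star, mul_comm ‖rightMul τ z ξ‖] at h
  obtain ⟨h, hh, rfl⟩ := exists_leftMul_eq hτ T hcomm
  exact ⟨h, hh.trans hT, huT⟩

lemma maxNorm_le_of_isDominated (hτ : τ.IsNormal) {ι : Type*} {u : ι → StrongDual ℂ S}
    {ξ : L2 τ} (hu : ∀ i, IsDominated (u i) (vectorFunctional τ ξ)) :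
    maxNorm τ u ≤ ENNReal.ofReal (‖ξ‖ ^ 2) := by
  choose h hh huh using fun i => exists_eq_inner_leftMul hτ (hu i)
  exact maxNorm_le_of_forall_eq τ ξ h hh huh

lemma limsupNorm_le_of_tendstoBAU (hτ : τ.IsNormal) {u : ℕ → ℕ → L1 τ} {G : ℕ → L1 τ} {G₀ : L1 τ}
    (hu : ∀ n m, IsDominated (u n m).toDual (G n).toDual) (hG : TendstoBAU τ G G₀) :
    limsupNorm τ u ≤ ‖G₀‖ₑ := by
  refine iSup₂_le fun ε hε => ENNReal.le_of_forall_pos_le_add fun δ hδ _ => ?_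
  obtain ⟨e, he, hτe, hlim⟩ := hG ε hε
  obtain ⟨ξ, hξ, N, hN⟩ := exists_vector_eventually_majorant τ he.one_sub hlim hδ
  -- `G n` does not depend on `m`, so only `n` has to be large and `K = 0` serves.
  refine iInf₂_le_of_le e he (iInf₂_le_of_le hτe N (iInf_le_of_le 0 ?_))
  refine le_trans (maxNorm_le_of_isDominated hτ (ξ := ξ) fun i =>
    ((hu i.1 i.2).compress he.one_sub.isSelfAdjoint).mono (hN i.1 (le_of_lt i.1.2))) ?_
  rw [← ofReal_norm, ← ENNReal.ofReal_coe_nnreal]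
  exact (ENNReal.ofReal_le_ofReal hξ).trans ENNReal.ofReal_add_le

end Limsup

/-! ### One majorant for all `B m f`, transported by the maps `A n`. -/

section MaximalInequality

lemma le_mul_of_forall_pos_le_mul_add {a k D : ℝ≥0∞} (hk : k ≠ ∞)
    (h : ∀ δ : ℝ≥0∞, 0 < δ → a ≤ k * (D + δ)) : a ≤ k * D := by
  have h1 : Filter.Tendsto (fun δ : ℝ≥0∞ => k * (D + δ)) (nhdsWithin 0 (Set.Ioi 0))
      (nhds (k * (D + 0))) :=
    (ENNReal.Tendsto.const_mul (tendsto_const_nhds.add Filter.tendsto_id) (.inr hk)).mono_left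
      nhdsWithin_le_nhds
  rw [add_zero] at h1
  exact ge_of_tendsto h1 (Filter.eventually_of_mem self_mem_nhdsWithin h)

variable {M : Type u} [CStarAlgebra M] {τ : TracialState M}

lemma maxNorm_le_maxOpNorm_mul {Φ : ℝ → ℝ} {B : ℕ → L1 τ →ₗ[ℂ] L1 τ}
    (hB : maxOpNorm τ Φ B < ∞) {f : L1 τ} (hf : orliczNorm τ Φ f < ∞) :
    maxNorm τ (fun m => (B m f).toDual) ≤ maxOpNorm τ Φ B * orliczNorm τ Φ f := by
  rcases eq_or_ne (orliczNorm τ Φ f) 0 with h0 | h0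
  -- Division by the Orlicz norm is impossible here; finiteness of `maxOpNorm` supplies some
  -- admissible `C`, which forces the left side to be `0`.
  · obtain ⟨C, hC, -⟩ := sInf_lt_iff.mp hB
    have h := hC f hf
    rw [h0, mul_zero] at h ⊢
    exact h
  · rw [← ENNReal.div_le_iff h0 hf.ne]
    refine le_sInf fun C hC => ?_
    rw [ENNReal.div_le_iff h0 hf.ne]
    exact hC f hf

lemma exists_majorant_of_maxOpNorm {Φ : ℝ → ℝ} {A B : ℕ → L1 τ →ₗ[ℂ] L1 τ}
    (hA : ∀ n, IsPositivityPreserving τ (A n)) (hB : ∀ m, IsPositivityPreserving τ (B m))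
    (hBmax : maxOpNorm τ Φ B < ∞) {f : L1 τ} (hfsa : f.IsSA) (hf : orliczNorm τ Φ f < ∞)
    {δ : ℝ≥0∞} (hδ : 0 < δ) :
    ∃ g : L1 τ, ‖g‖ₑ ≤ maxOpNorm τ Φ B * orliczNorm τ Φ f + δ ∧
      ∀ n, IsPos (A n g).toDual ∧ ∀ m, IsDominated (A n (B m f)).toDual (A n g).toDual := by
  have hlt : maxNorm τ (fun m => (B m f).toDual) < maxOpNorm τ Φ B * orliczNorm τ Φ f + δ :=
    (maxNorm_le_maxOpNorm_mul hBmax hf).trans_lt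
      (ENNReal.lt_add_right (ENNReal.mul_ne_top hBmax.ne hf.ne) hδ.ne')
  obtain ⟨g, hg, hgB⟩ := exists_majorant_of_maxNorm_lt τ (fun m => (hB m).isSA hfsa) hlt
  have h1 : ∀ n m, IsPos ((A n g).toDual - (A n (B m f)).toDual) := fun n m => by
    rw [← L1.toDual_sub, ← map_sub]
    exact hA n _ (hgB m).1
  have h2 : ∀ n m, IsPos ((A n g).toDual + (A n (B m f)).toDual) := fun n m => by
    rw [← L1.toDual_add, ← map_add]
    exact hA n _ (hgB m).2
  -- Positivity of `A n g` follows from the bounds for any single `m`, here `m = 0`.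
  exact ⟨g, hg, fun n => ⟨isPos_of_isPos_sub_add (h1 n 0) (h2 n 0), fun m =>
    isDominated_of_isPos (h1 n m) (h2 n m)⟩⟩

end MaximalInequality

end NCIntegration

end

theorem theoremA {H : Type*} [NormedAddCommGroup H] [InnerProductSpace ℂ H] [CompleteSpace H]
    (S : VonNeumannAlgebra H) (τ : NCIntegration.TracialState S)
    (hτn : τ.IsNormal) (hτf : τ.IsFaithful)
    (Φ : ℝ → ℝ) (hΦ : NCIntegration.IsOrlicz Φ)
    (A B : ℕ → NCIntegration.L1 τ →ₗ[ℂ] NCIntegration.L1 τ)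
    (hA : ∀ n, NCIntegration.IsPositivityPreserving τ (A n))
    (hB : ∀ m, NCIntegration.IsPositivityPreserving τ (B m))
    (hBmax : NCIntegration.maxOpNorm τ Φ B < ∞)
    (F : NCIntegration.L1 τ →L[ℂ] NCIntegration.L1 τ)
    (hF : ∀ f, NCIntegration.TendstoBAU τ (fun n => A n f) (F f)) :
    (∀ f : NCIntegration.L1 τ, f.IsSA → NCIntegration.orliczNorm τ Φ f < ∞ →
      NCIntegration.limsupNorm τ (fun n m => A n (B m f)) ≤
        ‖F‖ₑ * NCIntegration.maxOpNorm τ Φ B * NCIntegration.orliczNorm τ Φ f) ∧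
    (∀ f g h : NCIntegration.L1 τ, g.IsSA → h.IsSA → f = g + Complex.I • h →
      NCIntegration.orliczNorm τ Φ g < ∞ → NCIntegration.orliczNorm τ Φ h < ∞ →
      NCIntegration.limsupNorm τ (fun n m => A n (B m f)) ≤
        ‖F‖ₑ * NCIntegration.maxOpNorm τ Φ B *
          (NCIntegration.orliczNorm τ Φ g + NCIntegration.orliczNorm τ Φ h)) := by
  have henorm : ∀ g : NCIntegration.L1 τ, ‖F g‖ₑ ≤ ‖F‖ₑ * ‖g‖ₑ := fun g => by
    rw [← ofReal_norm, ← ofReal_norm F, ← ofReal_norm g, ← ENNReal.ofReal_mul (norm_nonneg F)]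
    exact ENNReal.ofReal_le_ofReal (F.le_opNorm g)
  have hFtop : ‖F‖ₑ ≠ ∞ := enorm_ne_top
  refine ⟨fun f hfsa hf => ?_, fun f g h hgsa hhsa hfgh hg hh => ?_⟩
  · rw [mul_assoc]
    refine NCIntegration.le_mul_of_forall_pos_le_mul_add hFtop fun δ hδ => ?_
    obtain ⟨k, hk, hdom⟩ :=
      NCIntegration.exists_majorant_of_maxOpNorm hA hB hBmax hfsa hf hδ
    calc _ ≤ ‖F k‖ₑ :=
          NCIntegration.limsupNorm_le_of_tendstoBAU hτn (fun n => (hdom n).2) (hF k)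
      _ ≤ ‖F‖ₑ * ‖k‖ₑ := henorm k
      _ ≤ _ := by gcongr
  · rw [mul_assoc]
    refine NCIntegration.le_mul_of_forall_pos_le_mul_add hFtop fun δ hδ => ?_
    obtain ⟨k₁, hk₁, hdom₁⟩ := NCIntegration.exists_majorant_of_maxOpNorm hA hB hBmax hgsa hg
      (ENNReal.half_pos hδ.ne')
    obtain ⟨k₂, hk₂, hdom₂⟩ := NCIntegration.exists_majorant_of_maxOpNorm hA hB hBmax hhsa hh
      (ENNReal.half_pos hδ.ne')
    -- The majorants of the two parts are added before passing to the limit, so the b.a.u. limit is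
    -- used once, for `k₁ + k₂`.
    have hdom : ∀ n m, NCIntegration.IsDominated (A n (B m f)).toDual (A n (k₁ + k₂)).toDual :=
      fun n m => by
        rw [hfgh]
        simp only [map_add, map_smul, NCIntegration.L1.toDual_add, NCIntegration.L1.toDual_smul]
        exact ((hdom₁ n).2 m).add (((hdom₂ n).2 m).smul Complex.norm_I) (hdom₁ n).1 (hdom₂ n).1
    calc _ ≤ ‖F (k₁ + k₂)‖ₑ := NCIntegration.limsupNorm_le_of_tendstoBAU hτn hdom (hF _)
      _ ≤ ‖F‖ₑ * ‖k₁ + k₂‖ₑ := henorm _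
      _ ≤ ‖F‖ₑ * (‖k₁‖ₑ + ‖k₂‖ₑ) := by gcongr; exact enorm_add_le _ _
      _ ≤ ‖F‖ₑ * ((NCIntegration.maxOpNorm τ Φ B * NCIntegration.orliczNorm τ Φ g + δ / 2) +
            (NCIntegration.maxOpNorm τ Φ B * NCIntegration.orliczNorm τ Φ h + δ / 2)) := by gcongr
      _ = _ := by rw [add_add_add_comm, ENNReal.add_halves, mul_add (NCIntegration.maxOpNorm τ Φ B)]
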